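/- Let $n,r$ be integers with $0\le r<n$, let $M\subset\mathbb{C}^{n+1}$ be a smooth ($C^\infty$) embedded real hypersurface, and let $p_0\in M$. For a local smooth defining function $\rho$ of $M$ (so $M=\{\rho=0\}$ locally and $d\rho\neq 0$), the Levi form of $M$ at $p\in M$ is the Hermitian form $\frac{1}{2i}\,d\theta_p(\overline{L}',L)$ in the tangent vectors $L',L$ of type $(1,0)$ of $M$ at $p$, where $\theta(v)=d\rho(iv)$ is the real characteristic one-form of $M$ defined by $\rho$; its rank does not depend on $\rho$. Suppose that $M$ is Levi uniform of rank $r$ at $p_0$, i.e. that the rank of the Levi form of $M$ is equal to $r$ at every point of $M$ in a neighborhood of $p_0$. Then $M$ is foliated by complex manifolds of dimension $n-r$ in a neighborhood of $p_0$: there is a $C^\infty$ chart $(x,t)$ of $M$ around $p_0$ onto a product of open balls in $\mathbb{C}^{n-r}\times\mathbb{R}^{2r+1}$ such that every leaf $\{t=\mathrm{const}\}$ is a complex submanifold of $\mathbb{C}^{n+1}$ of complex dimension $n-r$. -/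

import Mathlib

open scoped ContDiff

noncomputable section

/-- The space `ℂ^m`. -/
abbrev CSpace (m : ℕ) : Type := EuclideanSpace ℂ (Fin m)

/-- `ρ` is a smooth defining function on the open set `U` for the set `M`:
`M ∩ U` is the zero set of `ρ` in `U`, and `dρ` vanishes nowhere on `U`. -/
structure IsDefiningFunctionOn {m : ℕ} (M U : Set (CSpace m)) (ρ : CSpace m → ℝ) : Prop where
  isOpen : IsOpen U
  contDiffOn : ContDiffOn ℝ ∞ ρ U
  inter_eq : M ∩ U = {z ∈ U | ρ z = 0}
  fderiv_ne_zero : ∀ z ∈ U, fderiv ℝ ρ z ≠ 0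

/-- `M ⊆ ℂ^m` is a (smooth, embedded) real hypersurface. -/
def IsRealHypersurface {m : ℕ} (M : Set (CSpace m)) : Prop :=
  ∀ p ∈ M, ∃ (U : Set (CSpace m)) (ρ : CSpace m → ℝ), p ∈ U ∧ IsDefiningFunctionOn M U ρ

theorem CSpace.smul_eq {m : ℕ} (c : ℂ) (v : CSpace m) :
    c • v = c.re • v + c.im • (Complex.I • v) := by
  ext j
  simp only [PiLp.smul_apply, PiLp.add_apply, smul_eq_mul, Complex.real_smul]
  conv_lhs => rw [← Complex.re_add_im c]
  ring

theorem CSpace.I_smul_smul {m : ℕ} (c : ℂ) (v : CSpace m) :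
    Complex.I • (c • v) = c.re • (Complex.I • v) + (-c.im) • v := by
  rw [CSpace.smul_eq c v]
  ext j
  simp only [PiLp.smul_apply, PiLp.add_apply, smul_eq_mul, Complex.real_smul]
  push_cast
  linear_combination (c.im * v j : ℂ) * Complex.I_mul_I

/-- The complex tangent space `T_p M ∩ i T_p M`, where `T_p M = ker dρ_p`. A vector `v` in it
stands for the tangent vector `L_v = ∑ v_j ∂/∂z_j = (v - i ⊗ (i v)) / 2` of type (1,0), an element
of the conjugate of the CR bundle; the vector of type (0,1) conjugate to it is
`(v + i ⊗ (i v)) / 2`. -/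
def holTangent {m : ℕ} (ρ : CSpace m → ℝ) (p : CSpace m) : Submodule ℂ (CSpace m) where
  carrier := {v | fderiv ℝ ρ p v = 0 ∧ fderiv ℝ ρ p (Complex.I • v) = 0}
  zero_mem' := by simp
  add_mem' := by
    rintro v w ⟨h1, h2⟩ ⟨h3, h4⟩
    simp [smul_add, h1, h2, h3, h4]
  smul_mem' := by
    rintro c v ⟨h1, h2⟩
    constructor
    · rw [CSpace.smul_eq c v, map_add, map_smul, map_smul, h1, h2]; simp
    · rw [CSpace.I_smul_smul c v, map_add, map_smul _ c.re, map_smul _ (-c.im), h1, h2]; simp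

/-- The real one-form `θ = dρ ∘ (multiplication by i)`. Its restriction to `M = {ρ = 0}` is a
nonvanishing characteristic form: on `T_p M` its kernel is the complex tangent space. -/
def charForm {m : ℕ} (ρ : CSpace m → ℝ) (z : CSpace m) : CSpace m [⋀^Fin 1]→L[ℝ] ℝ :=
  ContinuousAlternatingMap.ofSubsingleton ℝ (CSpace m) ℝ (0 : Fin 1)
    ((fderiv ℝ ρ z).comp
      ((Complex.I • ContinuousLinearMap.id ℂ (CSpace m)).restrictScalars ℝ))

/-- The exterior derivative `dθ_p(v, w)` of the characteristic form. -/
def dCharForm {m : ℕ} (ρ : CSpace m → ℝ) (p v w : CSpace m) : ℝ :=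
  extDeriv (charForm ρ) p ![v, w]

/-- The Levi form `(1 / 2i) dθ_p(conj L_w, L_v)`, where `dθ_p` is extended complex bilinearly and
`conj L_w = (w + i ⊗ (i w)) / 2`, `L_v = (v - i ⊗ (i v)) / 2`. -/
def leviValue {m : ℕ} (ρ : CSpace m → ℝ) (p w v : CSpace m) : ℂ :=
  1 / (2 * Complex.I) * ((1 / 4 : ℂ) *
    (((dCharForm ρ p w v + dCharForm ρ p (Complex.I • w) (Complex.I • v) : ℝ) : ℂ) +
      Complex.I *
        ((dCharForm ρ p (Complex.I • w) v - dCharForm ρ p w (Complex.I • v) : ℝ) : ℂ)))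

theorem dCharForm_add_left {m : ℕ} (ρ : CSpace m → ℝ) (p v v' w : CSpace m) :
    dCharForm ρ p (v + v') w = dCharForm ρ p v w + dCharForm ρ p v' w := by
  have h : ∀ x : CSpace m, Function.update ![0, w] (0 : Fin 2) x = ![x, w] := by
    intro x; ext i; fin_cases i <;> simp
  have := (extDeriv (charForm ρ) p).map_update_add ![0, w] 0 v v'
  simp only [h] at this
  exact this

theorem dCharForm_smul_left {m : ℕ} (ρ : CSpace m → ℝ) (p : CSpace m) (a : ℝ) (v w : CSpace m) :
    dCharForm ρ p (a • v) w = a * dCharForm ρ p v w := by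
  have h : ∀ x : CSpace m, Function.update ![0, w] (0 : Fin 2) x = ![x, w] := by
    intro x; ext i; fin_cases i <;> simp
  have := (extDeriv (charForm ρ) p).map_update_smul ![0, w] 0 a v
  simp only [h] at this
  exact this

theorem dCharForm_add_right {m : ℕ} (ρ : CSpace m → ℝ) (p v w w' : CSpace m) :
    dCharForm ρ p v (w + w') = dCharForm ρ p v w + dCharForm ρ p v w' := by
  have h : ∀ x : CSpace m, Function.update ![v, 0] (1 : Fin 2) x = ![v, x] := by
    intro x; ext i; fin_cases i <;> simp
  have := (extDeriv (charForm ρ) p).map_update_add ![v, 0] 1 w w'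
  simp only [h] at this
  exact this

theorem dCharForm_smul_right {m : ℕ} (ρ : CSpace m → ℝ) (p : CSpace m) (a : ℝ) (v w : CSpace m) :
    dCharForm ρ p v (a • w) = a * dCharForm ρ p v w := by
  have h : ∀ x : CSpace m, Function.update ![v, 0] (1 : Fin 2) x = ![v, x] := by
    intro x; ext i; fin_cases i <;> simp
  have := (extDeriv (charForm ρ) p).map_update_smul ![v, 0] 1 a w
  simp only [h] at this
  exact this

theorem leviValue_add_left {m : ℕ} (ρ : CSpace m → ℝ) (p w w' v : CSpace m) :
    leviValue ρ p (w + w') v = leviValue ρ p w v + leviValue ρ p w' v := by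
  simp only [leviValue, smul_add, dCharForm_add_left]
  push_cast
  ring

theorem leviValue_add_right {m : ℕ} (ρ : CSpace m → ℝ) (p w v v' : CSpace m) :
    leviValue ρ p w (v + v') = leviValue ρ p w v + leviValue ρ p w v' := by
  simp only [leviValue, smul_add, dCharForm_add_right]
  push_cast
  ring

theorem leviValue_smul_left {m : ℕ} (ρ : CSpace m → ℝ) (p : CSpace m) (c : ℂ) (w v : CSpace m) :
    leviValue ρ p (c • w) v = (starRingEnd ℂ) c * leviValue ρ p w v := by
  simp only [leviValue, CSpace.I_smul_smul c w]
  rw [CSpace.smul_eq c w]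
  simp only [dCharForm_add_left, dCharForm_smul_left]
  have hc : (starRingEnd ℂ) c = c.re - c.im * Complex.I := by
    apply Complex.ext <;> simp
  rw [hc]
  push_cast
  ring_nf
  simp only [Complex.I_sq]
  ring

theorem leviValue_smul_right {m : ℕ} (ρ : CSpace m → ℝ) (p : CSpace m) (c : ℂ) (w v : CSpace m) :
    leviValue ρ p w (c • v) = c * leviValue ρ p w v := by
  simp only [leviValue, CSpace.I_smul_smul c v]
  rw [CSpace.smul_eq c v]
  simp only [dCharForm_add_right, dCharForm_smul_right]
  have hc : c = c.re + c.im * Complex.I := (Complex.re_add_im c).symm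
  conv_rhs => rw [hc]
  push_cast
  ring_nf
  simp only [Complex.I_sq]
  ring

/-- The Levi form at `p`, a sesquilinear form on the space of tangent vectors of type (1,0),
conjugate linear in the first variable. -/
def leviForm {m : ℕ} (ρ : CSpace m → ℝ) (p : CSpace m) :
    holTangent ρ p →ₗ⋆[ℂ] holTangent ρ p →ₗ[ℂ] ℂ :=
  LinearMap.mk₂'ₛₗ (starRingEnd ℂ) (RingHom.id ℂ)
    (fun w v => leviValue ρ p (w : CSpace m) (v : CSpace m))
    (fun w w' v => leviValue_add_left ρ p w w' v)
    (fun c w v => leviValue_smul_left ρ p c w v)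
    (fun w v v' => leviValue_add_right ρ p w v v')
    (fun c w v => leviValue_smul_right ρ p c w v)

/-- The rank of the Levi form at `p`. -/
def leviRank {m : ℕ} (ρ : CSpace m → ℝ) (p : CSpace m) : ℕ :=
  Module.finrank ℂ (LinearMap.range (leviForm ρ p))

/-- `M` is Levi uniform of rank `r` at `p₀`: the rank of the Levi form is equal to `r` at all points
of `M` in a neighborhood of `p₀`. (Another defining function multiplies the Levi form by a
nonvanishing function on `M`, so that the rank does not depend on `ρ`.) -/
def IsLeviUniformAt {m : ℕ} (M : Set (CSpace m)) (p₀ : CSpace m) (r : ℕ) : Prop :=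
  ∃ (U : Set (CSpace m)) (ρ : CSpace m → ℝ), p₀ ∈ U ∧ IsDefiningFunctionOn M U ρ ∧
    ∀ p ∈ M ∩ U, leviRank ρ p = r

/-- `N ⊆ ℂ^m` is a (locally closed) complex submanifold of complex dimension `d`: near each of its
points it is the zero set of a holomorphic submersion to `ℂ^c`, where `d + c = m`. -/
def IsComplexSubmanifold {m : ℕ} (d : ℕ) (N : Set (CSpace m)) : Prop :=
  ∃ c : ℕ, d + c = m ∧ ∀ p ∈ N, ∃ (W : Set (CSpace m)) (f : CSpace m → CSpace c),
    IsOpen W ∧ p ∈ W ∧ DifferentiableOn ℂ f W ∧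
      (∀ z ∈ W, Function.Surjective (fderiv ℂ f z)) ∧ N ∩ W = {z ∈ W | f z = 0}

/-- The real hypersurface `M ⊆ ℂ^m` is foliated by complex manifolds of dimension `d` in a
neighborhood of `p₀ ∈ M`: there is a smooth chart `Φ = (x, t, s)` of `ℂ^m` around `p₀`, onto a
product of balls in `ℂ^d × ℝ^q × ℝ`, in which `M` is `{s = 0}` (so that `(x, t)` is a smooth chart
of `M`), and for which every leaf `{t = const, s = 0}` is a complex submanifold of dimension `d`.
The transverse dimension `q` is the real codimension of the leaves in `M`. -/
def IsFoliatedByComplexManifoldsNear {m : ℕ} (M : Set (CSpace m)) (p₀ : CSpace m) (d : ℕ) : Prop :=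
  ∃ (q : ℕ) (Φ : OpenPartialHomeomorph (CSpace m) (CSpace d × EuclideanSpace ℝ (Fin q) × ℝ))
    (ε : ℝ),
    2 * d + q + 1 = 2 * m ∧ 0 < ε ∧ p₀ ∈ Φ.source ∧
    Φ.target = Metric.ball 0 ε ×ˢ Metric.ball 0 ε ×ˢ Metric.ball 0 ε ∧
    ContDiffOn ℝ ∞ Φ Φ.source ∧ ContDiffOn ℝ ∞ Φ.symm Φ.target ∧
    M ∩ Φ.source = {z ∈ Φ.source | (Φ z).2.2 = 0} ∧
    ∀ t ∈ Metric.ball (0 : EuclideanSpace ℝ (Fin q)) ε,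
      IsComplexSubmanifold d {z ∈ Φ.source | (Φ z).2.1 = t ∧ (Φ z).2.2 = 0}

end

/-! The Levi null space at a point of `M` consists of the complex tangent vectors `v` with `dθ(v, w)
= 0` for every complex tangent `w`. Constant rank makes these spaces a bundle of complex dimension
`n - r` over `M`. The bundle is involutive: for null fields `V₁`, `V₂` and a complex tangent field
`W`, all terms of `d(dθ)(V₁, V₂, W) = 0` vanish except `dθ([V₁, V₂], W)`, so this one vanishes too.
Frobenius then gives leaves, and these are complex submanifolds because their tangent spaces are
complex subspaces.

Near `p₀` the null spaces extend off `M` as kernels of surjective complex linear maps `S z`, whose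
rows are `∂ρ` and `r` Levi functionals (`exists_involutive_leviRows`). In adapted linear coordinates
the kernels are graphs of complex linear maps `A(x, y)`, and the leaves are graphs `y = f(x, y₀)`
with `D_x f = A(x, f)` and `f(0, y₀) = y₀`.

This Frobenius problem is solved in two stages. `exists_radial_solution` solves the equation along
rays, with smooth dependence on direction and initial value, by the inverse function theorem on a
space of curves. `fderiv_eq_of_radial` shows by Gronwall that a radial solution solves the full
equation wherever the integrability condition holds along it. That condition is known only on `M`;
but `ker S ⊆ ker dρ` everywhere, so `ρ` is constant on each radial graph and a graph that starts in
`M` stays in `M`. `exists_leaf_map` combines these facts. The chart inverts `(x, y) ↦ p₀ + e (x, f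
(x, y))` and takes `ρ` as the last transverse coordinate. -/

noncomputable section

/-! ### Superposition and Volterra operators on spaces of continuous curves. -/

namespace ContinuousMap

variable {K : Type*} [TopologicalSpace K] [CompactSpace K]

/-- Pointwise application of a family of continuous linear maps to a family of vectors. -/
def pointwiseApply {E F : Type*} [NormedAddCommGroup E] [NormedSpace ℝ E]
    [NormedAddCommGroup F] [NormedSpace ℝ F] :
    C(K, E →L[ℝ] F) →L[ℝ] C(K, E) →L[ℝ] C(K, F) :=
  LinearMap.mkContinuous₂
    (LinearMap.mk₂ ℝ (fun (A : C(K, E →L[ℝ] F)) (g : C(K, E)) =>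
        (⟨fun k => A k (g k), by fun_prop⟩ : C(K, F)))
      (fun A B g => by ext; simp) (fun c A g => by ext; simp)
      (fun A g h => by ext; simp) (fun c A g => by ext; simp)) 1
    (fun A g => by
      rw [one_mul]
      refine (ContinuousMap.norm_le _ (by positivity)).2 fun k => ?_
      exact ((A k).le_opNorm _).trans
        (mul_le_mul (A.norm_coe_le_norm k) (g.norm_coe_le_norm k) (norm_nonneg _) (by positivity)))

@[simp]
theorem pointwiseApply_apply {E F : Type*} [NormedAddCommGroup E] [NormedSpace ℝ E]
    [NormedAddCommGroup F] [NormedSpace ℝ F] (A : C(K, E →L[ℝ] F)) (g : C(K, E)) (k : K) :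
    pointwiseApply A g k = A k (g k) := rfl

/-- The Nemytskii operator of a `C^1` map is differentiable. -/
theorem hasFDerivAt_comp_left {E F : Type*} [NormedAddCommGroup E] [NormedSpace ℝ E]
    [NormedAddCommGroup F] [NormedSpace ℝ F] (f : C(E, F)) (f' : C(E, E →L[ℝ] F))
    (hf : ∀ x, HasFDerivAt f (f' x) x) (g : C(K, E)) :
    HasFDerivAt (fun g : C(K, E) => f.comp g) (pointwiseApply (f'.comp g)) g := by
  rw [hasFDerivAt_iff_isLittleO_nhds_zero, Asymptotics.isLittleO_iff]
  intro ε hε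
  -- Postcomposition with `f'` is continuous in the sup norm because `K` is compact; this gives one
  -- `δ` for all `k` without uniform continuity of `f'` on `E`.
  have hc : ContinuousAt (fun g : C(K, E) => f'.comp g) g :=
    (ContinuousMap.continuous_postcomp f').continuousAt
  obtain ⟨δ, hδ, H⟩ := Metric.mem_nhds_iff.1
    (hc.preimage_mem_nhds (Metric.ball_mem_nhds (f'.comp g) hε))
  filter_upwards [Metric.ball_mem_nhds (0 : C(K, E)) hδ] with h hh
  rw [mem_ball_zero_iff] at hh
  refine (ContinuousMap.norm_le _ (by positivity)).2 fun k => ?_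
  have hs : ∀ z ∈ segment ℝ (g k) (g k + h k), ‖f' z - f' (g k)‖ ≤ ε := by
    intro z hz
    rw [segment_eq_image'] at hz
    obtain ⟨t, ht, rfl⟩ := hz
    have h1 : dist (g + t • h) g < δ := by
      rw [dist_eq_norm, add_sub_cancel_left, norm_smul, Real.norm_of_nonneg ht.1]
      exact (mul_le_of_le_one_left (norm_nonneg _) ht.2).trans_lt hh
    have h2 : dist (f'.comp (g + t • h)) (f'.comp g) < ε := H h1
    have h3 := (ContinuousMap.dist_apply_le_dist (f := f'.comp (g + t • h)) (g := f'.comp g) k)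
    rw [dist_eq_norm] at h3
    have h4 := h3.trans h2.le
    simpa using h4
  have := (convex_segment (g k) (g k + h k)).norm_image_sub_le_of_norm_hasFDerivWithin_le'
    (f := f) (f' := f') (φ := f' (g k)) (C := ε)
    (fun z _ => (hf z).hasFDerivWithinAt) hs (left_mem_segment ℝ _ _) (right_mem_segment ℝ _ _)
  rw [add_sub_cancel_left] at this
  exact this.trans (mul_le_mul_of_nonneg_left (h.norm_coe_le_norm k) hε.le)

/-- The derivative of the operator is again a superposition operator, now with values in `E →L[ℝ]
F`. The induction therefore varies `F`, and `E` and `F` share a universe so that `E →L[ℝ] F` stays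
in it. -/
theorem contDiff_nat_comp_left.{u} {E : Type u} [NormedAddCommGroup E] [NormedSpace ℝ E] (n : ℕ) :
    ∀ {F : Type u} [NormedAddCommGroup F] [NormedSpace ℝ F] (f : C(E, F)), ContDiff ℝ n f →
      ContDiff ℝ n (fun g : C(K, E) => f.comp g) := by
  induction n with
  | zero =>
    intro F _ _ f _
    exact contDiff_zero.2 (ContinuousMap.continuous_postcomp f)
  | succ n ih =>
    intro F _ _ f hf
    have h1 : ContDiff ℝ (n + 1 : ℕ) f := hf
    have hd : ContDiff ℝ n (fderiv ℝ f) := h1.fderiv_right (by norm_cast)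
    let f' : C(E, E →L[ℝ] F) := ⟨fderiv ℝ f, hd.continuous⟩
    refine contDiff_succ_iff_hasFDerivAt.2
      ⟨fun g => pointwiseApply (f'.comp g), ?_, fun g => ?_⟩
    · exact pointwiseApply.contDiff.comp (ih f' hd)
    · refine hasFDerivAt_comp_left f f' (fun x => ?_) g
      exact ((h1.differentiable (by norm_num)) x).hasFDerivAt

theorem contDiff_comp_left.{u} {E F : Type u} [NormedAddCommGroup E] [NormedSpace ℝ E]
    [NormedAddCommGroup F] [NormedSpace ℝ F] (f : C(E, F)) (hf : ContDiff ℝ ∞ f) :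
    ContDiff ℝ ∞ (fun g : C(K, E) => f.comp g) :=
  contDiff_infty.2 fun n => contDiff_nat_comp_left n f (contDiff_infty.1 hf n)

/-- The Volterra operator `φ ↦ (t ↦ ∫_0^t φ)` on continuous curves. -/
def volterra (Y : Type*) [NormedAddCommGroup Y] [NormedSpace ℝ Y] [CompleteSpace Y] :
    C(Set.Icc (0 : ℝ) 1, Y) →L[ℝ] C(Set.Icc (0 : ℝ) 1, Y) :=
  LinearMap.mkContinuous
    { toFun := fun φ => ⟨fun t => ∫ s in (0 : ℝ)..t, Set.IccExtend zero_le_one φ s,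
        (intervalIntegral.continuous_primitive
          (fun a b => (φ.continuous.Icc_extend').intervalIntegrable a b) 0).comp
            continuous_subtype_val⟩
      map_add' := fun φ ψ => by
        ext t
        simp only [ContinuousMap.coe_mk, ContinuousMap.add_apply]
        rw [← intervalIntegral.integral_add (φ.continuous.Icc_extend'.intervalIntegrable _ _)
          (ψ.continuous.Icc_extend'.intervalIntegrable _ _)]
        rfl
      map_smul' := fun c φ => by
        ext t
        simp only [ContinuousMap.coe_mk, ContinuousMap.smul_apply, RingHom.id_apply]
        rw [← intervalIntegral.integral_smul]
        rfl } 1 (fun φ => by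
      rw [one_mul]
      refine (ContinuousMap.norm_le _ (by positivity)).2 fun t => ?_
      have := intervalIntegral.norm_integral_le_of_norm_le_const
        (f := Set.IccExtend zero_le_one φ) (C := ‖φ‖) (a := 0) (b := (t : ℝ))
        (fun s _ => φ.norm_coe_le_norm _)
      refine this.trans ?_
      rw [sub_zero, abs_of_nonneg t.2.1]
      exact mul_le_of_le_one_right (norm_nonneg _) t.2.2)

theorem volterra_apply {Y : Type*} [NormedAddCommGroup Y] [NormedSpace ℝ Y] [CompleteSpace Y]
    (φ : C(Set.Icc (0 : ℝ) 1, Y)) (t : Set.Icc (0 : ℝ) 1) :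
    volterra Y φ t = ∫ s in (0 : ℝ)..t, Set.IccExtend zero_le_one φ s := rfl

end ContinuousMap

/-! ### The smooth inverse function theorem. -/

/-- The inverse function theorem for `C^∞` maps, with a local inverse that is smooth on an open
set. -/
theorem ContDiffOn.exists_openPartialHomeomorph {E F : Type*} [NormedAddCommGroup E]
    [NormedSpace ℝ E] [CompleteSpace E] [NormedAddCommGroup F] [NormedSpace ℝ F] {f : E → F}
    {U : Set E} (hf : ContDiffOn ℝ ∞ f U) (hU : IsOpen U) {a : E} (ha : a ∈ U) (f' : E ≃L[ℝ] F)
    (hf' : HasFDerivAt f (f' : E →L[ℝ] F) a) :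
    ∃ e : OpenPartialHomeomorph E F, a ∈ e.source ∧ e.source ⊆ U ∧ (e : E → F) = f ∧
      ContDiffOn ℝ ∞ e e.source ∧ ContDiffOn ℝ ∞ e.symm e.target := by
  have hfa : ∀ x ∈ U, ContDiffAt ℝ ∞ f x := fun x hx => hf.contDiffAt (hU.mem_nhds hx)
  have hinf : (∞ : WithTop ℕ∞) ≠ 0 := by simp
  let e₀ := (hfa a ha).toOpenPartialHomeomorph f hf' hinf
  -- Restricting to the points with invertible derivative makes the inverse smooth on the whole
  -- target, not only near the image of `a`.
  let V : Set E := U ∩ fderiv ℝ f ⁻¹' Set.range ((↑) : (E ≃L[ℝ] F) → E →L[ℝ] F)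
  have hV : IsOpen V :=
    (hf.continuousOn_fderiv_of_isOpen hU (by simp)).isOpen_inter_preimage hU
      ContinuousLinearEquiv.isOpen
  have haV : a ∈ V := ⟨ha, f', hf'.fderiv.symm⟩
  refine ⟨e₀.restrOpen V hV, ⟨(hfa a ha).mem_toOpenPartialHomeomorph_source hf' hinf, haV⟩,
    fun x hx => hx.2.1, rfl, ?_, ?_⟩
  · exact hf.mono fun x hx => hx.2.1
  · intro y hy
    have h1 := (e₀.restrOpen V hV).map_target hy
    obtain ⟨g, hg⟩ := h1.2.2
    refine ((e₀.restrOpen V hV).contDiffAt_symm (f₀' := g) hy ?_ ?_).contDiffWithinAt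
    · rw [hg]
      exact ((hfa _ h1.2.1).differentiableAt hinf).hasFDerivAt
    · exact hfa _ h1.2.1

/-! ### Solving `D_x f = A(x, f)` along rays. -/

section RadialSolution

open ContinuousMap Set

/-- The curve `s ↦ (x, (s x, g s))` attached to a vector `x` and a curve `g`. -/
def radialLift (X Y : Type*) [NormedAddCommGroup X] [NormedSpace ℝ X] [NormedAddCommGroup Y]
    [NormedSpace ℝ Y] :
    X × C(Icc (0 : ℝ) 1, Y) →L[ℝ] C(Icc (0 : ℝ) 1, X × (X × Y)) :=
  LinearMap.mkContinuous
    { toFun := fun p => ⟨fun s => (p.1, ((s : ℝ) • p.1, p.2 s)), by fun_prop⟩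
      map_add' := fun p q => by ext s <;> simp
      map_smul' := fun c p => by
        ext s
        · rfl
        · exact smul_comm _ _ _
        · rfl } 1 (fun p => by
      rw [one_mul]
      refine (ContinuousMap.norm_le _ (by positivity)).2 fun s => ?_
      have h1 : ‖(s : ℝ) • p.1‖ ≤ ‖p.1‖ := by
        rw [norm_smul, Real.norm_of_nonneg s.2.1]
        exact mul_le_of_le_one_left (norm_nonneg _) s.2.2
      have h2 : ‖p.2 s‖ ≤ ‖p.2‖ := p.2.norm_coe_le_norm s
      have h3 : ‖p.1‖ ≤ ‖p‖ := norm_fst_le p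
      have h4 : ‖p.2‖ ≤ ‖p‖ := norm_snd_le p
      exact norm_prod_le_iff.2 ⟨h3, norm_prod_le_iff.2 ⟨h1.trans h3, h2.trans h4⟩⟩)

@[simp]
theorem radialLift_apply {X Y : Type*} [NormedAddCommGroup X] [NormedSpace ℝ X]
    [NormedAddCommGroup Y] [NormedSpace ℝ Y] (p : X × C(Icc (0 : ℝ) 1, Y)) (s : Icc (0 : ℝ) 1) :
    radialLift X Y p s = (p.1, ((s : ℝ) • p.1, p.2 s)) := rfl

/-- The integral operator `(x, g) ↦ (t ↦ ∫_0^t A(s x, g s) x ds)`. -/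
def radialIntegral {X Y : Type*} [NormedAddCommGroup X] [NormedSpace ℝ X] [NormedAddCommGroup Y]
    [NormedSpace ℝ Y] [CompleteSpace Y] (F : C(X × (X × Y), Y)) (p : X × C(Icc (0 : ℝ) 1, Y)) :
    C(Icc (0 : ℝ) 1, Y) :=
  volterra Y (F.comp (radialLift X Y p))

theorem radialIntegral_apply {X Y : Type*} [NormedAddCommGroup X] [NormedSpace ℝ X]
    [NormedAddCommGroup Y] [NormedSpace ℝ Y] [CompleteSpace Y] (F : C(X × (X × Y), Y))
    (p : X × C(Icc (0 : ℝ) 1, Y)) (t : Icc (0 : ℝ) 1) :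
    radialIntegral F p t =
      ∫ s in (0 : ℝ)..t, F (p.1, (s • p.1, Set.IccExtend zero_le_one p.2 s)) := by
  rw [radialIntegral, volterra_apply]
  refine intervalIntegral.integral_congr fun s hs => ?_
  rw [uIcc_of_le t.2.1] at hs
  have hs' : s ∈ Icc (0 : ℝ) 1 := ⟨hs.1, hs.2.trans t.2.2⟩
  simp only [Set.IccExtend_of_mem _ _ hs']
  simp

/-- Rescaling of a curve on `[0, 1]`. -/
def rescaleCurve {Y : Type*} [TopologicalSpace Y] (t : Icc (0 : ℝ) 1) (g : C(Icc (0 : ℝ) 1, Y)) :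
    C(Icc (0 : ℝ) 1, Y) :=
  g.comp ⟨fun s => ⟨t * s, mul_nonneg t.2.1 s.2.1, mul_le_one₀ t.2.2 s.2.1 s.2.2⟩, by fun_prop⟩

theorem rescaleCurve_apply {Y : Type*} [TopologicalSpace Y] (t : Icc (0 : ℝ) 1)
    (g : C(Icc (0 : ℝ) 1, Y)) (s : Icc (0 : ℝ) 1) :
    rescaleCurve t g s = Set.IccExtend zero_le_one g (t * s) := by
  rw [Set.IccExtend_of_mem _ _
    (show (t * s : ℝ) ∈ Icc (0 : ℝ) 1 from
      ⟨mul_nonneg t.2.1 s.2.1, mul_le_one₀ t.2.2 s.2.1 s.2.2⟩)]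
  rfl

/-- Substitution `σ ↦ t σ` in the integral; homogeneity of `F` in the direction absorbs the factor
`t`. This scaling later identifies the solution in direction `t x` with a piece of the solution in
direction `x`. -/
theorem radialIntegral_rescale {X Y : Type*} [NormedAddCommGroup X] [NormedSpace ℝ X]
    [NormedAddCommGroup Y] [NormedSpace ℝ Y] [CompleteSpace Y] (F : C(X × (X × Y), Y))
    (hF : ∀ (c : ℝ) (x : X) (z : X × Y), F (c • x, z) = c • F (x, z))
    (x : X) (g : C(Icc (0 : ℝ) 1, Y)) (t : Icc (0 : ℝ) 1) :
    radialIntegral F ((t : ℝ) • x, rescaleCurve t g) = rescaleCurve t (radialIntegral F (x, g)) := by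
  ext s
  rw [radialIntegral_apply]
  have h1 : rescaleCurve t (radialIntegral F (x, g)) s =
      ∫ σ in (0 : ℝ)..(t * s), F (x, (σ • x, Set.IccExtend zero_le_one g σ)) := by
    change radialIntegral F (x, g) ⟨t * s, _⟩ = _
    rw [radialIntegral_apply]
  rw [h1]
  have h2 := intervalIntegral.smul_integral_comp_mul_left (a := (0 : ℝ)) (b := s)
    (fun σ => F (x, (σ • x, Set.IccExtend zero_le_one g σ))) (t : ℝ)
  rw [mul_zero] at h2
  rw [← h2, ← intervalIntegral.integral_smul]
  refine intervalIntegral.integral_congr fun σ hσ => ?_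
  rw [uIcc_of_le s.2.1] at hσ
  have hσ' : σ ∈ Icc (0 : ℝ) 1 := ⟨hσ.1, hσ.2.trans s.2.2⟩
  simp only [hF]
  congr 2
  rw [Set.IccExtend_of_mem _ _ hσ', rescaleCurve_apply, smul_smul, mul_comm σ]

/-- Since `N` has zero derivative at the origin, the shear has identity derivative there. Its local
inverse solves `g = y + N (x, g)` smoothly in `(x, y)`. -/
theorem exists_openPartialHomeomorph_shear {X Z : Type*} [NormedAddCommGroup X] [NormedSpace ℝ X]
    [CompleteSpace X] [NormedAddCommGroup Z] [NormedSpace ℝ Z] [CompleteSpace Z] (N : X × Z → Z)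
    (hN : ContDiff ℝ ∞ N) (hN' : HasFDerivAt N (0 : X × Z →L[ℝ] Z) 0) (hN0 : N 0 = 0) :
    ∃ e : OpenPartialHomeomorph (X × Z) (X × Z), 0 ∈ e.source ∧ e 0 = 0 ∧
      (∀ p, e p = (p.1, p.2 - N p)) ∧ ContDiffOn ℝ ∞ e.symm e.target := by
  let H : X × Z → X × Z := fun p => (p.1, p.2 - N p)
  have hH : ContDiff ℝ ∞ H := contDiff_fst.prodMk (contDiff_snd.sub hN)
  have hH0 : HasFDerivAt H (ContinuousLinearEquiv.refl ℝ (X × Z) : X × Z →L[ℝ] X × Z) 0 := by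
    have h1 := (hasFDerivAt_fst (𝕜 := ℝ) (p := (0 : X × Z))).prodMk
      ((hasFDerivAt_snd (𝕜 := ℝ) (p := (0 : X × Z))).sub hN')
    refine h1.congr_fderiv ?_
    ext p <;> simp
  obtain ⟨e, he0, -, heH, -, hes⟩ := hH.contDiffOn.exists_openPartialHomeomorph isOpen_univ
    (mem_univ 0) _ hH0
  refine ⟨e, he0, ?_, fun p => by rw [heH], hes⟩
  rw [heH]
  simp [H, hN0]

/-- Solutions of the total differential equation `D_x f = A(x, f)` along rays through the origin,
depending smoothly on the direction and on the initial value. -/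
theorem exists_radial_solution.{u} {X Y : Type u} [NormedAddCommGroup X] [NormedSpace ℝ X]
    [CompleteSpace X] [NormedAddCommGroup Y] [NormedSpace ℝ Y] [CompleteSpace Y]
    (A : X × Y → X →L[ℝ] Y) (hA : ContDiff ℝ ∞ A) (hA0 : A 0 = 0) :
    ∃ δ > 0, ∃ f : X × Y → Y, ContDiffOn ℝ ∞ f (Metric.ball 0 δ) ∧
      (∀ y, ((0 : X), y) ∈ Metric.ball (0 : X × Y) δ → f (0, y) = y) ∧
      ∀ x y, (x, y) ∈ Metric.ball (0 : X × Y) δ → ∀ t ∈ Icc (0 : ℝ) 1,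
        HasDerivWithinAt (fun s : ℝ => f (s • x, y)) (A (t • x, f (t • x, y)) x)
          (Icc (0 : ℝ) 1) t := by
  have hFs : ContDiff ℝ ∞ (fun p : X × (X × Y) => A p.2 p.1) :=
    (hA.comp contDiff_snd).clm_apply contDiff_fst
  let F : C(X × (X × Y), Y) := ⟨fun p => A p.2 p.1, hFs.continuous⟩
  have hFsmul : ∀ (c : ℝ) (x : X) (z : X × Y), F (c • x, z) = c • F (x, z) := fun c x z => by
    simp [F]
  have hN : ContDiff ℝ ∞ (radialIntegral F) :=
    (volterra Y).contDiff.comp ((contDiff_comp_left F hFs).comp (radialLift X Y).contDiff)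
  -- Both factors of `A(z) x` vanish at the origin, so the integral operator has no linear part
  -- there.
  have hF0 : fderiv ℝ F 0 = 0 := by
    have h1 : HasFDerivAt (fun p : X × (X × Y) => A p.2 p.1) _ 0 :=
      (((hA.differentiable (by simp)).comp differentiable_snd) 0).hasFDerivAt.clm_apply
        (hasFDerivAt_fst (𝕜 := ℝ) (p := (0 : X × (X × Y))))
    refine h1.fderiv.trans ?_
    ext p <;> simp [hA0]
  have hN0 : HasFDerivAt (𝕜 := ℝ) (radialIntegral F) 0 0 := by
    have hd : ContDiff ℝ 0 (fderiv ℝ F) := hFs.fderiv_right (by simp)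
    let f' : C(X × (X × Y), X × (X × Y) →L[ℝ] Y) := ⟨fderiv ℝ F, hd.continuous⟩
    have h1 := hasFDerivAt_comp_left (K := Icc (0 : ℝ) 1) F f'
      (fun p => ((hFs.differentiable (by simp)) p).hasFDerivAt) (radialLift X Y 0)
    have h2 : pointwiseApply (f'.comp (radialLift X Y 0)) = 0 := by
      have : f'.comp (radialLift X Y 0) = 0 := by
        ext1 k
        change fderiv ℝ F (radialLift X Y 0 k) = 0
        simpa using hF0
      rw [this, map_zero]
    rw [h2] at h1
    have h3 := (volterra Y).hasFDerivAt.comp (0 : X × C(Icc (0 : ℝ) 1, Y))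
      (h1.comp (0 : X × C(Icc (0 : ℝ) 1, Y)) (radialLift X Y).hasFDerivAt)
    refine h3.congr_fderiv ?_
    simp
  have hx0 : ∀ g : C(Icc (0 : ℝ) 1, Y), radialIntegral F (0, g) = 0 := fun g => by
    have h : radialIntegral F ((0 : ℝ) • 0, _) = _ := radialIntegral_rescale F hFsmul 0 g
      ⟨0, left_mem_Icc.2 zero_le_one⟩
    ext t
    rw [radialIntegral_apply]
    simp [F]
  obtain ⟨e, he0, heval, heH, hes⟩ := exists_openPartialHomeomorph_shear (radialIntegral F) hN hN0
    (hx0 0)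
  obtain ⟨δ₀, hδ₀, hball⟩ := Metric.isOpen_iff.1 e.open_source 0 he0
  let cst : X × Y →L[ℝ] X × C(Icc (0 : ℝ) 1, Y) :=
    (ContinuousLinearMap.fst ℝ X Y).prod
      ((ContinuousLinearMap.const ℝ (Icc (0 : ℝ) 1)).comp (ContinuousLinearMap.snd ℝ X Y))
  have ht0 : (0 : X × C(Icc (0 : ℝ) 1, Y)) ∈ e.target := by
    rw [← heval]; exact e.map_source he0
  have hsymm0 : e.symm 0 = 0 := by rw [← heval, e.left_inv he0, heval]
  have hnear : ∀ᶠ p in nhds (0 : X × Y), cst p ∈ e.target ∧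
      e.symm (cst p) ∈ Metric.ball (0 : X × C(Icc (0 : ℝ) 1, Y)) δ₀ := by
    have hc : Filter.Tendsto cst (nhds 0) (nhds 0) := by
      simpa using cst.continuous.tendsto 0
    have hs : Filter.Tendsto e.symm (nhds 0) (nhds 0) := by
      simpa [hsymm0] using (e.symm.continuousAt (x := 0) ht0).tendsto
    exact (hc.eventually (e.open_target.mem_nhds ht0)).and
      ((hs.comp hc).eventually (Metric.ball_mem_nhds _ hδ₀))
  obtain ⟨δ, hδ, hδball⟩ := Metric.eventually_nhds_iff_ball.1 hnear
  let γ : X × Y → C(Icc (0 : ℝ) 1, Y) := fun p => (e.symm (cst p)).2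
  have hγ : ∀ p ∈ Metric.ball (0 : X × Y) δ, (e.symm (cst p)).1 = p.1 ∧
      γ p = (cst p).2 + radialIntegral F (p.1, γ p) := by
    intro p hp
    have h1 : e (e.symm (cst p)) = cst p := by
      exact e.right_inv (hδball p hp).1
    rw [heH] at h1
    have h2 : (e.symm (cst p)).1 = p.1 := congrArg Prod.fst h1
    have h3 : (e.symm (cst p)).2 - radialIntegral F (e.symm (cst p)) = (cst p).2 :=
      congrArg Prod.snd h1
    refine ⟨h2, ?_⟩
    rw [← h3, ← h2]
    simp [γ]
  -- The rescaled curve solves the integral equation for direction `t x` and the same initial value.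
  -- Rescaling does not increase norms, so it stays in the ball inside `e.source`, where `e` is
  -- injective and the solution is unique.
  have hscale : ∀ x y, (x, y) ∈ Metric.ball (0 : X × Y) δ → ∀ t : Icc (0 : ℝ) 1,
      γ ((t : ℝ) • x, y) = rescaleCurve t (γ (x, y)) := by
    intro x y hxy t
    obtain ⟨h1, h2⟩ := hγ _ hxy
    have hb : ((t : ℝ) • x, rescaleCurve t (γ (x, y))) ∈
        Metric.ball (0 : X × C(Icc (0 : ℝ) 1, Y)) δ₀ := by
      have h3 := (hδball _ hxy).2
      rw [mem_ball_zero_iff] at h3 ⊢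
      refine lt_of_le_of_lt (norm_prod_le_iff.2 ⟨?_, ?_⟩) h3
      · rw [norm_smul, Real.norm_of_nonneg t.2.1]
        change _ * ‖((x, y) : X × Y).1‖ ≤ _
        rw [← h1]
        exact (mul_le_of_le_one_left (norm_nonneg _) t.2.2).trans
          (norm_fst_le (e.symm (cst (x, y))))
      · refine le_trans ?_ (norm_snd_le (e.symm (cst (x, y))))
        exact (ContinuousMap.norm_le _ (norm_nonneg _)).2 fun s =>
          (γ (x, y)).norm_coe_le_norm _
    have hHeq : e ((t : ℝ) • x, rescaleCurve t (γ (x, y))) = cst ((t : ℝ) • x, y) := by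
      rw [heH]
      refine Prod.ext rfl ?_
      change rescaleCurve t (γ (x, y)) - radialIntegral F _ = _
      rw [radialIntegral_rescale F hFsmul]
      ext s
      have := congrArg (fun g => rescaleCurve t g s) h2
      change rescaleCurve t (γ (x, y)) s =
        y + rescaleCurve t (radialIntegral F (x, γ (x, y))) s at this
      rw [ContinuousMap.sub_apply, this, add_sub_cancel_right]
      rfl
    change (e.symm (cst ((t : ℝ) • x, y))).2 = _
    rw [← hHeq, e.left_inv (hball hb)]
  let one : Icc (0 : ℝ) 1 := ⟨1, right_mem_Icc.2 zero_le_one⟩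
  refine ⟨δ, hδ, fun p => γ p one, ?_, ?_, ?_⟩
  · have hev : ContDiff ℝ ∞ (fun g : C(Icc (0 : ℝ) 1, Y) => g one) :=
      (IsLinearMap.with_bound (f := fun g : C(Icc (0 : ℝ) 1, Y) => g one)
        ⟨fun _ _ => rfl, fun _ _ => rfl⟩ 1
        (fun g => by simpa using g.norm_coe_le_norm one)).contDiff
    refine hev.comp_contDiffOn (contDiff_snd.comp_contDiffOn ?_)
    exact hes.comp cst.contDiff.contDiffOn fun p hp => (hδball p hp).1
  · intro y hy
    have h := (hγ _ hy).2
    rw [hx0] at h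
    change γ (0, y) one = y
    rw [h]
    simp [cst]
  · intro x y hxy t ht
    -- By scaling, the endpoint map restricted to a ray is the solution curve itself.
    have key : ∀ s ∈ Icc (0 : ℝ) 1, γ (s • x, y) one = Set.IccExtend zero_le_one (γ (x, y)) s := by
      intro s hs
      rw [hscale x y hxy ⟨s, hs⟩, rescaleCurve_apply]
      simp [one]
    have key2 : ∀ s ∈ Icc (0 : ℝ) 1, γ (s • x, y) one =
        y + ∫ σ in (0 : ℝ)..s, F (x, (σ • x, Set.IccExtend zero_le_one (γ (x, y)) σ)) := by
      intro s hs
      rw [key s hs, Set.IccExtend_of_mem _ _ hs, (hγ _ hxy).2, ContinuousMap.add_apply,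
        radialIntegral_apply, ← (hγ _ hxy).2]
      rfl
    have hcont : Continuous fun σ : ℝ => F (x, (σ • x, Set.IccExtend zero_le_one (γ (x, y)) σ)) :=
      F.continuous.comp (continuous_const.prodMk ((continuous_id.smul continuous_const).prodMk
        (γ (x, y)).continuous.Icc_extend'))
    have hder : HasDerivAt (fun s : ℝ => y + ∫ σ in (0 : ℝ)..s,
        F (x, (σ • x, Set.IccExtend zero_le_one (γ (x, y)) σ)))
        (F (x, (t • x, Set.IccExtend zero_le_one (γ (x, y)) t))) t :=
      (intervalIntegral.integral_hasDerivAt_right (hcont.intervalIntegrable _ _)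
        (hcont.stronglyMeasurableAtFilter _ _) hcont.continuousAt).const_add y
    have h := hder.hasDerivWithinAt (s := Icc (0 : ℝ) 1)
    rw [← key t ht] at h
    exact h.congr key2 (key2 t ht)

end RadialSolution

/-! ### From radial solutions to full solutions. -/

section TotalDifferentialEquation

open Set

variable {X Y : Type*} [NormedAddCommGroup X] [NormedSpace ℝ X] [NormedAddCommGroup Y]
  [NormedSpace ℝ Y]

theorem smul_mem_ball_zero {δ : ℝ} {x : X} (hx : x ∈ Metric.ball (0 : X) δ) {t : ℝ}
    (ht : t ∈ Icc (0 : ℝ) 1) : t • x ∈ Metric.ball (0 : X) δ := by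
  rw [mem_ball_zero_iff] at hx ⊢
  rw [norm_smul, Real.norm_of_nonneg ht.1]
  exact (mul_le_of_le_one_left (norm_nonneg _) ht.2).trans_lt hx

theorem fderiv_self_eq_of_hasDerivWithinAt {g : X → Y} {x : X} {b : Y}
    (hg : DifferentiableAt ℝ g x)
    (h : HasDerivWithinAt (fun s : ℝ => g (s • x)) b (Icc (0 : ℝ) 1) 1) : fderiv ℝ g x x = b := by
  have h1 : HasDerivAt (fun s : ℝ => s • x) x 1 := by
    simpa using (hasDerivAt_id (1 : ℝ)).smul_const x
  have h2 : HasDerivAt (fun s : ℝ => g (s • x)) (fderiv ℝ g x x) 1 := by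
    refine HasFDerivAt.comp_hasDerivAt (1 : ℝ) ?_ h1
    rw [one_smul]
    exact hg.hasFDerivAt
  exact (uniqueDiffOn_Icc_zero_one 1 (right_mem_Icc.2 zero_le_one)).eq_deriv _
    h2.hasDerivWithinAt h

/-- A radial solution of `D g = A(x, g)` along which the integrability condition holds is a
solution. -/
theorem fderiv_eq_of_radial (A : X × Y → X →L[ℝ] Y) (hA : ContDiff ℝ ∞ A) {δ : ℝ} (g : X → Y)
    (hg : ContDiffOn ℝ ∞ g (Metric.ball 0 δ))
    (hrad : ∀ x ∈ Metric.ball (0 : X) δ, fderiv ℝ g x x = A (x, g x) x)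
    (hint : ∀ x ∈ Metric.ball (0 : X) δ, ∀ u v,
      fderiv ℝ A (x, g x) (u, A (x, g x) u) v = fderiv ℝ A (x, g x) (v, A (x, g x) v) u) :
    ∀ x ∈ Metric.ball (0 : X) δ, fderiv ℝ g x = A (x, g x) := by
  intro x hx
  ext u
  have hgat : ∀ z ∈ Metric.ball (0 : X) δ, ContDiffAt ℝ ∞ g z := fun z hz =>
    hg.contDiffAt (Metric.isOpen_ball.mem_nhds hz)
  have hgd : ∀ z ∈ Metric.ball (0 : X) δ, HasFDerivAt g (fderiv ℝ g z) z := fun z hz =>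
    ((hgat z hz).differentiableAt (by simp)).hasFDerivAt
  have hgdd : ∀ z ∈ Metric.ball (0 : X) δ,
      HasFDerivAt (fderiv ℝ g) (fderiv ℝ (fderiv ℝ g) z) z := fun z hz =>
    (((hgat z hz).fderiv_right (m := ∞) (by simp)).differentiableAt
      (by simp)).hasFDerivAt
  have hAd : ∀ p, HasFDerivAt A (fderiv ℝ A p) p := fun p =>
    (hA.differentiable (by simp) p).hasFDerivAt
  have hsymm : ∀ z ∈ Metric.ball (0 : X) δ, ∀ a b,
      fderiv ℝ (fderiv ℝ g) z a b = fderiv ℝ (fderiv ℝ g) z b a := fun z hz a b =>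
    ((hgat z hz).isSymmSndFDerivAt (by
      rw [minSmoothness_of_isRCLikeNormedField]; exact WithTop.coe_le_coe.2 (le_top : (2 : ℕ∞) ≤ ⊤))) a b
  have hAg : ∀ z ∈ Metric.ball (0 : X) δ, HasFDerivAt (fun z => A (z, g z))
      ((fderiv ℝ A (z, g z)).comp ((ContinuousLinearMap.id ℝ X).prod (fderiv ℝ g z))) z :=
    fun z hz => (hAd _).comp z ((hasFDerivAt_id z).prodMk (hgd z hz))
  -- The radial identity `Dg(z) z = A(z, g z) z`, differentiated in the direction `u`.
  have hR : ∀ z ∈ Metric.ball (0 : X) δ,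
      fderiv ℝ (fderiv ℝ g) z u z + fderiv ℝ g z u =
        fderiv ℝ A (z, g z) (u, fderiv ℝ g z u) z + A (z, g z) u := by
    intro z hz
    have h1 := (hgdd z hz).clm_apply (hasFDerivAt_id z)
    have h2 := (hAg z hz).clm_apply (hasFDerivAt_id z)
    have h3 := h1.congr_of_eventuallyEq (f₁ := fun z => A (z, g z) z)
      (Filter.eventually_of_mem (Metric.isOpen_ball.mem_nhds hz) fun z hz => (hrad z hz).symm)
    have h4 := congrArg (fun L : X →L[ℝ] Y => L u) (h3.unique h2)
    simpa [add_comm] using h4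
  have hline : ∀ t : ℝ, HasDerivAt (fun s : ℝ => s • x) x t := fun t => by
    simpa using (hasDerivAt_id t).smul_const x
  have hz : ∀ t ∈ Icc (0 : ℝ) 1, t • x ∈ Metric.ball (0 : X) δ := fun t ht =>
    smul_mem_ball_zero hx ht
  -- The defect of the equation along the ray, multiplied by `t`. The factor gives `w 0 = 0` and
  -- matches the radial identity at `t x`, which controls only `t • Dg(t x) x`. It turns out that
  -- `w` solves the homogeneous linear equation `w' = D_y A(w) x`, so Gronwall forces `w 1 = 0`.
  let w : ℝ → Y := fun t => t • fderiv ℝ g (t • x) u - t • A (t • x, g (t • x)) u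
  let w' : ℝ → Y := fun t => fderiv ℝ A (t • x, g (t • x)) (0, w t) x
  have hw : ∀ t ∈ Icc (0 : ℝ) 1, HasDerivAt w (w' t) t := by
    intro t ht
    have hzt := hz t ht
    have d1 : HasDerivAt (fun s : ℝ => fderiv ℝ g (s • x) u)
        (fderiv ℝ (fderiv ℝ g) (t • x) x u) t :=
      (ContinuousLinearMap.apply ℝ Y u).hasFDerivAt.comp_hasDerivAt t
        ((hgdd _ hzt).comp_hasDerivAt t (hline t))
    have d2 : HasDerivAt (fun s : ℝ => A (s • x, g (s • x)))
        (fderiv ℝ A (t • x, g (t • x)) (x, fderiv ℝ g (t • x) x)) t :=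
      HasFDerivAt.comp_hasDerivAt (f := fun s : ℝ => s • x) t (hAg _ hzt) (hline t)
    have d3 : HasDerivAt (fun s : ℝ => A (s • x, g (s • x)) u)
        (fderiv ℝ A (t • x, g (t • x)) (x, fderiv ℝ g (t • x) x) u) t :=
      (ContinuousLinearMap.apply ℝ Y u).hasFDerivAt.comp_hasDerivAt t d2
    have h1 : HasDerivAt (fun s : ℝ => s • fderiv ℝ g (s • x) u)
        (t • fderiv ℝ (fderiv ℝ g) (t • x) x u + (1 : ℝ) • fderiv ℝ g (t • x) u) t :=
      (hasDerivAt_id' t).smul d1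
    have h2 : HasDerivAt (fun s : ℝ => s • A (s • x, g (s • x)) u)
        (t • fderiv ℝ A (t • x, g (t • x)) (x, fderiv ℝ g (t • x) x) u +
          (1 : ℝ) • A (t • x, g (t • x)) u) t := (hasDerivAt_id' t).smul d3
    refine (h1.sub h2).congr_deriv ?_
    have e1 := hR _ hzt
    have e2 : t • fderiv ℝ g (t • x) x = t • A (t • x, g (t • x)) x := by
      rw [← map_smul, ← map_smul]; exact hrad _ hzt
    -- Integrability exchanges `x` and `u`, after `e2` has replaced `Dg x` by `A x`.
    have e3 : t • fderiv ℝ A (t • x, g (t • x)) (x, fderiv ℝ g (t • x) x) u =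
        t • fderiv ℝ A (t • x, g (t • x)) (u, A (t • x, g (t • x)) u) x := by
      rw [hint _ hzt u x, ← smul_apply, ← map_smul,
        ← smul_apply, ← map_smul, Prod.smul_mk, Prod.smul_mk, e2]
    have e4 : w' t = t • fderiv ℝ A (t • x, g (t • x)) (u, fderiv ℝ g (t • x) u) x -
        t • fderiv ℝ A (t • x, g (t • x)) (u, A (t • x, g (t • x)) u) x := by
      rw [← smul_sub, ← sub_apply, ← map_sub, Prod.mk_sub_mk, sub_self,
        ← smul_apply, ← map_smul, Prod.smul_mk, smul_zero, smul_sub]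
    rw [map_smul, map_smul] at e1
    rw [e4, e3, hsymm _ hzt x u, one_smul, one_smul]
    linear_combination (norm := module) e1
  have hcont : ContinuousOn (fun t : ℝ => ‖fderiv ℝ A (t • x, g (t • x))‖) (Icc 0 1) := by
    refine (hA.continuous_fderiv (by simp)).norm.comp_continuousOn
      (ContinuousOn.prodMk (by fun_prop) ?_)
    exact hg.continuousOn.comp (by fun_prop) hz
  obtain ⟨K, hK⟩ := isCompact_Icc.exists_bound_of_continuousOn hcont
  have hgr := norm_le_gronwallBound_of_norm_deriv_right_le (f := w) (f' := w') (δ := 0)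
    (K := K * ‖x‖) (ε := 0) (a := 0) (b := 1)
    (fun t ht => (hw t ht).continuousAt.continuousWithinAt)
    (fun t ht => (hw t ⟨ht.1, ht.2.le⟩).hasDerivWithinAt) (by simp [w])
    (fun t ht => by
      have h1 := ContinuousLinearMap.le_opNorm (fderiv ℝ A (t • x, g (t • x)) (0, w t)) x
      have h2 := ContinuousLinearMap.le_opNorm (fderiv ℝ A (t • x, g (t • x))) (0, w t)
      have h3 : ‖((0 : X), w t)‖ = ‖w t‖ := by simp [Prod.norm_def]
      have h4 := hK t ⟨ht.1, ht.2.le⟩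
      replace h4 := (le_abs_self _).trans h4
      rw [h3] at h2
      rw [add_zero]
      calc ‖w' t‖ ≤ ‖fderiv ℝ A (t • x, g (t • x)) (0, w t)‖ * ‖x‖ := h1
        _ ≤ (K * ‖w t‖) * ‖x‖ := by gcongr; exact h2.trans (by gcongr)
        _ = K * ‖x‖ * ‖w t‖ := by ring) 1 (right_mem_Icc.2 zero_le_one)
  rw [gronwallBound_ε0_δ0, norm_le_zero_iff] at hgr
  simpa [w, sub_eq_zero] using hgr

end TotalDifferentialEquation

/-! ### Exterior derivatives of one-forms and brackets of null fields. -/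

section Brackets

open Filter Topology

variable {E : Type*} [NormedAddCommGroup E] [NormedSpace ℝ E]

/-- The differential of a function that vanishes on a level set of a submersion vanishes on the
tangent vectors of the level set. -/
theorem fderiv_apply_eq_zero_of_eventually_level [CompleteSpace E] {ρ g : E → ℝ} {z : E}
    (hρ : ContDiffAt ℝ 1 ρ z) (hg : ContDiffAt ℝ 1 g z) (hρ0 : fderiv ℝ ρ z ≠ 0)
    (h : ∀ᶠ x in 𝓝 z, ρ x = ρ z → g x = 0) {v : E} (hv : fderiv ℝ ρ z v = 0) :
    fderiv ℝ g z v = 0 := by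
  -- A function vanishing on the level set has a constrained extremum at every point of it. In the
  -- Lagrange relation the coefficient of `dg` is nonzero because `dρ ≠ 0`.
  have hextr : IsLocalExtrOn g {x | ρ x = ρ z} z := by
    left
    have hz : g z = 0 := h.self_of_nhds rfl
    filter_upwards [nhdsWithin_le_nhds h, self_mem_nhdsWithin] with x hx hx'
    rw [hz, hx hx']
  obtain ⟨a, b, hab, h1⟩ := hextr.exists_multipliers_of_hasStrictFDerivAt_1d
    (hρ.hasStrictFDerivAt (by simp)) (hg.hasStrictFDerivAt (by simp))
  have hb : b ≠ 0 := by
    rintro rfl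
    rw [zero_smul, add_zero] at h1
    rcases smul_eq_zero.1 h1 with rfl | h1
    · exact hab rfl
    · exact hρ0 h1
  have h2 : a * fderiv ℝ ρ z v + b * fderiv ℝ g z v = 0 :=
    congrArg (fun L : E →L[ℝ] ℝ => L v) h1
  rw [hv, mul_zero, zero_add] at h2
  exact (mul_eq_zero.1 h2).resolve_left hb

/-- The exterior derivative of the one-form `θ`, as a bilinear form. -/
def oneFormDeriv (θ : E → E →L[ℝ] ℝ) (z : E) : E →L[ℝ] E →L[ℝ] ℝ :=
  fderiv ℝ θ z - (fderiv ℝ θ z).flip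

theorem oneFormDeriv_apply (θ : E → E →L[ℝ] ℝ) (z v w : E) :
    oneFormDeriv θ z v w = fderiv ℝ θ z v w - fderiv ℝ θ z w v := rfl

theorem oneFormDeriv_swap (θ : E → E →L[ℝ] ℝ) (z v w : E) :
    oneFormDeriv θ z v w = -oneFormDeriv θ z w v := by
  simp [oneFormDeriv_apply]

theorem ContDiffAt.oneFormDeriv {θ : E → E →L[ℝ] ℝ} {z : E} (hθ : ContDiffAt ℝ ∞ θ z) :
    ContDiffAt ℝ ∞ (oneFormDeriv θ) z := by
  have h1 : ContDiffAt ℝ ∞ (fderiv ℝ θ) z := hθ.fderiv_right (by simp)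
  have h2 : IsBoundedLinearMap ℝ (fun L : E →L[ℝ] E →L[ℝ] ℝ => L.flip) :=
    IsLinearMap.with_bound ⟨fun _ _ => rfl, fun _ _ => rfl⟩ 1 (fun L => by simp)
  have h3 : ContDiff ℝ ∞ (fun L : E →L[ℝ] E →L[ℝ] ℝ => L.flip) := h2.contDiff
  exact h1.sub (h3.contDiffAt.comp z h1)

/-- Differentiate `α(V) = 0` along `W` and `α(W) = 0` along `V`, and subtract. -/
theorem apply_bracket_eq {α : E → E →L[ℝ] ℝ} {V W : E → E} {z : E}
    (hα : DifferentiableAt ℝ α z) (hV : DifferentiableAt ℝ V z) (hW : DifferentiableAt ℝ W z)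
    (hαV : ∀ᶠ x in 𝓝 z, α x (V x) = 0) (hαW : ∀ᶠ x in 𝓝 z, α x (W x) = 0) :
    α z (fderiv ℝ W z (V z) - fderiv ℝ V z (W z)) = -oneFormDeriv α z (V z) (W z) := by
  have key : ∀ {X : E → E}, DifferentiableAt ℝ X z → (∀ᶠ x in 𝓝 z, α x (X x) = 0) → ∀ v,
      α z (fderiv ℝ X z v) + fderiv ℝ α z v (X z) = 0 := by
    intro X hX h v
    have h1 := hα.hasFDerivAt.clm_apply hX.hasFDerivAt
    have h2 := h1.congr_of_eventuallyEq (f₁ := fun _ => (0 : ℝ)) (h.mono fun x hx => hx.symm)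
    have h3 := congrArg (fun L : E →L[ℝ] ℝ => L v) (h2.unique (hasFDerivAt_const (0 : ℝ) z))
    simpa using h3
  have h1 := key hV hαV (W z)
  have h2 := key hW hαW (V z)
  rw [map_sub, oneFormDeriv_apply]
  linarith

/-- The second derivatives of `θ` are kept explicit because they cancel in the cyclic sum over three
fields: this is `d(dθ) = 0`. -/
theorem fderiv_oneFormDeriv_apply {θ : E → E →L[ℝ] ℝ} {V W : E → E} {z : E}
    (hθ : ContDiffAt ℝ ∞ θ z) (hV : ContDiffAt ℝ ∞ V z) (hW : ContDiffAt ℝ ∞ W z) (v : E) :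
    fderiv ℝ (fun x => oneFormDeriv θ x (V x) (W x)) z v =
      fderiv ℝ (fderiv ℝ θ) z v (V z) (W z) - fderiv ℝ (fderiv ℝ θ) z v (W z) (V z) +
        oneFormDeriv θ z (fderiv ℝ V z v) (W z) + oneFormDeriv θ z (V z) (fderiv ℝ W z v) := by
  have hθ' : DifferentiableAt ℝ (fderiv ℝ θ) z :=
    (hθ.fderiv_right (m := ∞) (by simp)).differentiableAt (by simp)
  have hV' := (hV.differentiableAt (by simp)).hasFDerivAt
  have hW' := (hW.differentiableAt (by simp)).hasFDerivAt
  have h1 := (hθ'.hasFDerivAt.clm_apply hV').clm_apply hW'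
  have h2 := (hθ'.hasFDerivAt.clm_apply hW').clm_apply hV'
  have h3 : HasFDerivAt (fun x => oneFormDeriv θ x (V x) (W x)) _ z := h1.sub h2
  rw [h3.fderiv]
  simp [oneFormDeriv_apply]
  ring

/-- If `V₁`, `V₂` are null vectors of `dθ` on the common kernel of `dρ` and `θ` along a level set
of `ρ`, then so is their bracket. -/
theorem oneFormDeriv_bracket_eq_zero [CompleteSpace E] {ρ : E → ℝ} {θ : E → E →L[ℝ] ℝ}
    {V₁ V₂ W : E → E} {z : E} (hρ : ContDiffAt ℝ ∞ ρ z) (hρ0 : fderiv ℝ ρ z ≠ 0)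
    (hθ : ContDiffAt ℝ ∞ θ z) (hV₁ : ContDiffAt ℝ ∞ V₁ z) (hV₂ : ContDiffAt ℝ ∞ V₂ z)
    (hW : ContDiffAt ℝ ∞ W z)
    (hρV₁ : ∀ᶠ x in 𝓝 z, fderiv ℝ ρ x (V₁ x) = 0) (hρV₂ : ∀ᶠ x in 𝓝 z, fderiv ℝ ρ x (V₂ x) = 0)
    (hρW : ∀ᶠ x in 𝓝 z, fderiv ℝ ρ x (W x) = 0)
    (hθV₁ : ∀ᶠ x in 𝓝 z, θ x (V₁ x) = 0) (hθV₂ : ∀ᶠ x in 𝓝 z, θ x (V₂ x) = 0)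
    (hθW : ∀ᶠ x in 𝓝 z, θ x (W x) = 0)
    (hnull₁ : ∀ᶠ x in 𝓝 z, ρ x = ρ z → ∀ v, fderiv ℝ ρ x v = 0 → θ x v = 0 →
      oneFormDeriv θ x (V₁ x) v = 0)
    (hnull₂ : ∀ᶠ x in 𝓝 z, ρ x = ρ z → ∀ v, fderiv ℝ ρ x v = 0 → θ x v = 0 →
      oneFormDeriv θ x (V₂ x) v = 0) :
    oneFormDeriv θ z (fderiv ℝ V₂ z (V₁ z) - fderiv ℝ V₁ z (V₂ z)) (W z) = 0 := by
  have hρ1 : ContDiffAt ℝ 1 ρ z := hρ.of_le (by simp)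
  have hdρ : ContDiffAt ℝ ∞ (fderiv ℝ ρ) z := hρ.fderiv_right (by simp)
  have hω := hθ.oneFormDeriv
  have hpair : ∀ {X Y : E → E}, ContDiffAt ℝ ∞ X z → ContDiffAt ℝ ∞ Y z →
      ContDiffAt ℝ 1 (fun x => oneFormDeriv θ x (X x) (Y x)) z := fun hX hY =>
    ((hω.clm_apply hX).clm_apply hY).of_le (by simp)
  have h2le : (2 : WithTop ℕ∞) ≤ ∞ := WithTop.coe_le_coe.2 (le_top : (2 : ℕ∞) ≤ ⊤)
  have hsymm : ∀ a b, fderiv ℝ (fderiv ℝ θ) z a b = fderiv ℝ (fderiv ℝ θ) z b a := fun a b =>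
    (hθ.isSymmSndFDerivAt (by rw [minSmoothness_of_isRCLikeNormedField]; exact h2le)) a b
  have hsymmρ : ∀ a b, fderiv ℝ (fderiv ℝ ρ) z a b = fderiv ℝ (fderiv ℝ ρ) z b a := fun a b =>
    (hρ.isSymmSndFDerivAt (by rw [minSmoothness_of_isRCLikeNormedField]; exact h2le)) a b
  have hd : ∀ {X : E → E}, ContDiffAt ℝ ∞ X z → DifferentiableAt ℝ X z := fun hX =>
    hX.differentiableAt (by simp)
  -- Each pairing of two of the three fields vanishes on the level set of `ρ`, and the remaining
  -- field is tangent to it; hence the three cyclic derivatives vanish.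
  have e12 := fderiv_apply_eq_zero_of_eventually_level hρ1 (hpair hV₁ hV₂) hρ0
    (by filter_upwards [hnull₁, hρV₂, hθV₂] with x h1 h2 h3 h4 using h1 h4 _ h2 h3)
    hρW.self_of_nhds
  have e2W := fderiv_apply_eq_zero_of_eventually_level hρ1 (hpair hV₂ hW) hρ0
    (by filter_upwards [hnull₂, hρW, hθW] with x h1 h2 h3 h4 using h1 h4 _ h2 h3)
    hρV₁.self_of_nhds
  have eW1 := fderiv_apply_eq_zero_of_eventually_level hρ1 (hpair hW hV₁) hρ0
    (by
      filter_upwards [hnull₁, hρW, hθW] with x h1 h2 h3 h4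
      rw [oneFormDeriv_swap, h1 h4 _ h2 h3, neg_zero])
    hρV₂.self_of_nhds
  rw [fderiv_oneFormDeriv_apply hθ hV₁ hV₂] at e12
  rw [fderiv_oneFormDeriv_apply hθ hV₂ hW] at e2W
  rw [fderiv_oneFormDeriv_apply hθ hW hV₁] at eW1
  -- The brackets `[Vᵢ, W]` stay in `ker dρ ∩ ker θ`: for `dρ` because it is closed, for `θ` because
  -- `dθ(Vᵢ, W) = 0`. So nullity of `V₁` and `V₂` applies to them, and only the term with `[V₁, V₂]`
  -- survives.
  have hbr : ∀ {V : E → E}, ContDiffAt ℝ ∞ V z → (∀ᶠ x in 𝓝 z, fderiv ℝ ρ x (V x) = 0) →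
      (∀ᶠ x in 𝓝 z, θ x (V x) = 0) →
      (∀ᶠ x in 𝓝 z, ρ x = ρ z → ∀ v, fderiv ℝ ρ x v = 0 → θ x v = 0 →
        oneFormDeriv θ x (V x) v = 0) →
      fderiv ℝ ρ z (fderiv ℝ W z (V z) - fderiv ℝ V z (W z)) = 0 ∧
        θ z (fderiv ℝ W z (V z) - fderiv ℝ V z (W z)) = 0 := by
    intro V hV h1 h2 h3
    constructor
    · rw [apply_bracket_eq (hdρ.differentiableAt (by simp)) (hd hV) (hd hW) h1 hρW,
        oneFormDeriv_apply, hsymmρ, sub_self, neg_zero]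
    · rw [apply_bracket_eq (hθ.differentiableAt (by simp)) (hd hV) (hd hW) h2 hθW,
        h3.self_of_nhds rfl _ hρW.self_of_nhds hθW.self_of_nhds, neg_zero]
  have b1 := hbr hV₁ hρV₁ hθV₁ hnull₁
  have b2 := hbr hV₂ hρV₂ hθV₂ hnull₂
  have c1 := hnull₂.self_of_nhds rfl _ b1.1 b1.2
  have c2 := hnull₁.self_of_nhds rfl _ b2.1 b2.2
  rw [map_sub] at c1 c2
  rw [map_sub, sub_apply]
  rw [hsymm (W z) (V₁ z), hsymm (W z) (V₂ z)] at e12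
  rw [hsymm (V₁ z) (V₂ z)] at e2W
  rw [oneFormDeriv_swap θ z (W z), oneFormDeriv_swap θ z (fderiv ℝ W z (V₂ z))] at eW1
  rw [oneFormDeriv_swap θ z (fderiv ℝ V₁ z (V₂ z))]
  rw [oneFormDeriv_swap θ z (fderiv ℝ V₁ z (W z))] at e12
  rw [oneFormDeriv_swap θ z (W z)]
  linarith

end Brackets

/-! ### Complex linear maps and functionals obtained from real ones. -/

open Filter Topology

/-- A real linear map that commutes with the multiplication by `i`, as a complex linear map. -/
def ContinuousLinearMap.toComplexLinear {E F : Type*} [NormedAddCommGroup E] [NormedSpace ℝ E]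
    [NormedSpace ℂ E] [IsScalarTower ℝ ℂ E] [NormedAddCommGroup F] [NormedSpace ℝ F]
    [NormedSpace ℂ F] [IsScalarTower ℝ ℂ F] (L : E →L[ℝ] F)
    (h : ∀ v, L (Complex.I • v) = Complex.I • L v) : E →L[ℂ] F where
  toFun := L
  map_add' := L.map_add
  map_smul' c v := by
    have hE (w : E) : c • w = c.re • w + c.im • (Complex.I • w) := by
      conv_lhs => rw [← Complex.re_add_im c]
      rw [add_smul, mul_smul]
      exact congrArg₂ _ (algebraMap_smul ℂ c.re w) (algebraMap_smul ℂ c.im (Complex.I • w))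
    have hF (w : F) : c • w = c.re • w + c.im • (Complex.I • w) := by
      conv_lhs => rw [← Complex.re_add_im c]
      rw [add_smul, mul_smul]
      exact congrArg₂ _ (algebraMap_smul ℂ c.re w) (algebraMap_smul ℂ c.im (Complex.I • w))
    simp only [RingHom.id_apply, hE, hF, map_add, map_smul, h]
  cont := L.continuous

@[simp]
theorem ContinuousLinearMap.toComplexLinear_apply {E F : Type*} [NormedAddCommGroup E]
    [NormedSpace ℝ E] [NormedSpace ℂ E] [IsScalarTower ℝ ℂ E] [NormedAddCommGroup F]
    [NormedSpace ℝ F] [NormedSpace ℂ F] [IsScalarTower ℝ ℂ F] (L : E →L[ℝ] F)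
    (h : ∀ v, L (Complex.I • v) = Complex.I • L v) (v : E) : L.toComplexLinear h v = L v := rfl

namespace CSpace

variable {m : ℕ}

theorem I_smul_I_smul (v : CSpace m) : Complex.I • (Complex.I • v) = -v := by
  rw [smul_smul, Complex.I_mul_I, neg_one_smul]

/-- Multiplication by `i` as a real linear map. -/
def mulI (m : ℕ) : CSpace m →L[ℝ] CSpace m :=
  (Complex.I • ContinuousLinearMap.id ℂ (CSpace m)).restrictScalars ℝ

@[simp]
theorem mulI_apply (v : CSpace m) : mulI m v = Complex.I • v := rfl

/-- The complex linear functional with the real part `φ`. -/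
def complexify (φ : CSpace m →L[ℝ] ℝ) : CSpace m →L[ℂ] ℂ :=
  (Complex.ofRealCLM.comp φ - Complex.I • Complex.ofRealCLM.comp (φ.comp (mulI m))).toComplexLinear
    (fun v => by
      simp [I_smul_I_smul, mul_sub, ← mul_assoc, Complex.I_mul_I]
      ring)

theorem complexify_apply (φ : CSpace m →L[ℝ] ℝ) (v : CSpace m) :
    complexify φ v = φ v - Complex.I * φ (Complex.I • v) := rfl

theorem complexify_eq_zero_iff {φ : CSpace m →L[ℝ] ℝ} {v : CSpace m} :
    complexify φ v = 0 ↔ φ v = 0 ∧ φ (Complex.I • v) = 0 := by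
  rw [complexify_apply, Complex.ext_iff]
  simp

theorem _root_.ContDiffAt.complexify_apply {n : WithTop ℕ∞} {φ : CSpace m → CSpace m →L[ℝ] ℝ}
    {w : CSpace m → CSpace m} {z : CSpace m} (hφ : ContDiffAt ℝ n φ z) (hw : ContDiffAt ℝ n w z) :
    ContDiffAt ℝ n (fun x => complexify (φ x) (w x)) z := by
  have h1 : ContDiffAt ℝ n (fun x => Complex.ofRealCLM (φ x (w x))) z :=
    Complex.ofRealCLM.contDiff.contDiffAt.comp z (hφ.clm_apply hw)
  have h2 : ContDiffAt ℝ n (fun x => Complex.ofRealCLM (φ x (mulI m (w x)))) z :=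
    Complex.ofRealCLM.contDiff.contDiffAt.comp z
      (hφ.clm_apply ((mulI m).contDiff.contDiffAt.comp z hw))
  exact h1.sub (contDiffAt_const.mul h2)

theorem complexify_ne_zero {φ : CSpace m →L[ℝ] ℝ} (h : φ ≠ 0) : ∃ ξ, complexify φ ξ ≠ 0 := by
  obtain ⟨ξ, hξ⟩ := DFunLike.ne_iff.1 h
  exact ⟨ξ, fun h0 => hξ (complexify_eq_zero_iff.1 h0).1⟩

end CSpace

/-! ### The Levi form as a complexified exterior derivative. -/

section LeviForm

open CSpace

variable {m : ℕ}

/-- The real characteristic form `dρ ∘ i`. -/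
def realCharForm (ρ : CSpace m → ℝ) (z : CSpace m) : CSpace m →L[ℝ] ℝ :=
  (fderiv ℝ ρ z).comp (mulI m)

theorem realCharForm_apply (ρ : CSpace m → ℝ) (z v : CSpace m) :
    realCharForm ρ z v = fderiv ℝ ρ z (Complex.I • v) := rfl

theorem ContDiffAt.realCharForm {ρ : CSpace m → ℝ} {z : CSpace m} (hρ : ContDiffAt ℝ ∞ ρ z) :
    ContDiffAt ℝ ∞ (realCharForm ρ) z :=
  (hρ.fderiv_right (m := ∞) (by simp)).clm_comp contDiffAt_const

theorem fderiv_realCharForm_apply {ρ : CSpace m → ℝ} {z : CSpace m} (hρ : ContDiffAt ℝ ∞ ρ z)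
    (v w : CSpace m) :
    fderiv ℝ (realCharForm ρ) z v w = fderiv ℝ (fderiv ℝ ρ) z v (Complex.I • w) := by
  have h1 : HasFDerivAt (fderiv ℝ ρ) (fderiv ℝ (fderiv ℝ ρ) z) z :=
    ((hρ.fderiv_right (m := ∞) (by simp)).differentiableAt (by simp)).hasFDerivAt
  have h2 : HasFDerivAt (realCharForm ρ) _ z := h1.clm_comp (hasFDerivAt_const (mulI m) z)
  rw [h2.fderiv]
  simp

theorem dCharForm_eq_oneFormDeriv {ρ : CSpace m → ℝ} {z : CSpace m} (hρ : ContDiffAt ℝ ∞ ρ z)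
    (v w : CSpace m) : dCharForm ρ z v w = oneFormDeriv (realCharForm ρ) z v w := by
  have hd : DifferentiableAt ℝ (realCharForm ρ) z := hρ.realCharForm.differentiableAt (by simp)
  have h0 : charForm ρ = fun x =>
      ContinuousAlternatingMap.ofSubsingletonLIE (ι := Fin 1) (E := CSpace m) (F := ℝ) (𝕜 := ℝ) 0
        (realCharForm ρ x) := rfl
  have h1 : DifferentiableAt ℝ (charForm ρ) z := by
    rw [h0]
    exact (ContinuousAlternatingMap.ofSubsingletonLIE (ι := Fin 1) (E := CSpace m) (F := ℝ)
      (𝕜 := ℝ) 0).toContinuousLinearEquiv.differentiableAt.comp z hd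
  have h2 (a b : CSpace m) :
      fderiv ℝ (fun x => charForm ρ x ![a]) z b = fderiv ℝ (realCharForm ρ) z b a := by
    have h3 : (fun x => charForm ρ x ![a]) = fun x => realCharForm ρ x a := rfl
    rw [h3, fderiv_clm_apply hd (differentiableAt_const a)]
    simp
  rw [dCharForm, extDeriv_apply h1, oneFormDeriv_apply]
  have e0 : (0 : Fin 2).removeNth ![v, w] = ![w] := by ext i; fin_cases i; rfl
  have e1 : (1 : Fin 2).removeNth ![v, w] = ![v] := by ext i; fin_cases i; rfl
  rw [Fin.sum_univ_two, e0, e1, h2, h2]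
  simp [sub_eq_add_neg]

/-- Here `dθ(v, w) = D²ρ(v, i w) - D²ρ(w, i v)`, and symmetry of `D²ρ` gives the invariance; `dθ` is
of type (1,1). -/
theorem oneFormDeriv_I_smul_I_smul {ρ : CSpace m → ℝ} {z : CSpace m} (hρ : ContDiffAt ℝ ∞ ρ z)
    (v w : CSpace m) :
    oneFormDeriv (realCharForm ρ) z (Complex.I • v) (Complex.I • w) =
      oneFormDeriv (realCharForm ρ) z v w := by
  have h2le : (2 : WithTop ℕ∞) ≤ ∞ := WithTop.coe_le_coe.2 (le_top : (2 : ℕ∞) ≤ ⊤)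
  have hsymm : ∀ a b, fderiv ℝ (fderiv ℝ ρ) z a b = fderiv ℝ (fderiv ℝ ρ) z b a := fun a b =>
    (hρ.isSymmSndFDerivAt (by rw [minSmoothness_of_isRCLikeNormedField]; exact h2le)) a b
  simp only [oneFormDeriv_apply, fderiv_realCharForm_apply hρ, I_smul_I_smul, map_neg]
  rw [hsymm v, hsymm w]
  ring

/-- Invariance under `i` makes the four terms of the Levi form coincide in pairs. The formula holds
for all vectors, so the Levi functionals extend from the complex tangent space to all of `ℂ^m`. -/
theorem leviValue_eq_complexify {ρ : CSpace m → ℝ} {z : CSpace m} (hρ : ContDiffAt ℝ ∞ ρ z)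
    (w v : CSpace m) :
    leviValue ρ z w v =
      1 / (4 * Complex.I) * complexify (oneFormDeriv (realCharForm ρ) z w) v := by
  have h1 := oneFormDeriv_I_smul_I_smul hρ w v
  have h2 := oneFormDeriv_I_smul_I_smul hρ (Complex.I • w) v
  rw [I_smul_I_smul, map_neg, neg_apply] at h2
  simp only [leviValue, dCharForm_eq_oneFormDeriv hρ, h1, ← h2, complexify_apply]
  push_cast
  field_simp
  ring

end LeviForm

open CSpace

/-! ### The Levi null spaces as an involutive family of kernels. -/

section NullFrame

variable {m r : ℕ}

/-- The complex linear map to `ℂ^c` with the given real parts of the components. -/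
def rowsMap {c : ℕ} (φ : Fin c → CSpace m →L[ℝ] ℝ) : CSpace m →L[ℂ] CSpace c :=
  (EuclideanSpace.equiv (Fin c) ℂ).symm.toContinuousLinearMap.comp
    (ContinuousLinearMap.pi fun j => complexify (φ j))

theorem rowsMap_apply {c : ℕ} (φ : Fin c → CSpace m →L[ℝ] ℝ) (v : CSpace m) (j : Fin c) :
    rowsMap φ v j = complexify (φ j) v := rfl

theorem rowsMap_eq_zero_iff {c : ℕ} {φ : Fin c → CSpace m →L[ℝ] ℝ} {v : CSpace m} :
    rowsMap φ v = 0 ↔ ∀ j, complexify (φ j) v = 0 := by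
  refine ⟨fun h j => ?_, fun h => ?_⟩
  · rw [← rowsMap_apply, h]; rfl
  · ext j; rw [rowsMap_apply, h]; rfl

theorem contDiffOn_rowsMap {c : ℕ} {φ : CSpace m → Fin c → CSpace m →L[ℝ] ℝ} {s : Set (CSpace m)}
    (hs : IsOpen s) (hφ : ∀ j, ContDiffOn ℝ ∞ (fun z => φ z j) s) :
    ContDiffOn ℝ ∞ (fun z => (rowsMap (φ z)).restrictScalars ℝ) s := by
  rw [contDiffOn_clm_apply]
  intro v z hz
  refine ContDiffAt.contDiffWithinAt ?_
  rw [contDiffAt_piLp]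
  intro j
  exact ((hφ j).contDiffAt (hs.mem_nhds hz)).complexify_apply contDiffAt_const

/-- A proper range lies in the kernel of a nonzero functional, whose coordinates are a linear
relation between the rows. -/
theorem LinearMap.surjective_of_forall_sum_eq_zero {E : Type*} [AddCommGroup E] [Module ℂ E]
    {c : ℕ} (T : E →ₗ[ℂ] CSpace c)
    (h : ∀ a : Fin c → ℂ, (∀ v, ∑ j, a j * T v j = 0) → a = 0) : Function.Surjective T := by
  rw [← LinearMap.range_eq_top]
  by_contra hne
  obtain ⟨f, hf, hle⟩ := Submodule.exists_le_ker_of_lt_top _ (lt_top_iff_ne_top.2 hne)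
  have hsum : ∀ y : CSpace c, f y = ∑ j, f (EuclideanSpace.single j 1) * y j := by
    intro y
    conv_lhs => rw [← (EuclideanSpace.basisFun (Fin c) ℂ).sum_repr y]
    simp [map_sum, mul_comm]
  have h0 := h (fun j => f (EuclideanSpace.single j 1)) fun v => by
    rw [← hsum]; exact hle (LinearMap.mem_range_self T v)
  refine hf (LinearMap.ext fun y => ?_)
  rw [hsum]
  simp [fun j => congrFun h0 j]

/-- The vector field with the constant part `h` projected along `ξ` to the complex tangent spaces of
the level sets of `ρ`. -/
def tangentField (ρ : CSpace m → ℝ) (ξ h z : CSpace m) : CSpace m :=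
  h - (complexify (fderiv ℝ ρ z) h * (complexify (fderiv ℝ ρ z) ξ)⁻¹) • ξ

theorem complexify_tangentField {ρ : CSpace m → ℝ} {ξ h z : CSpace m}
    (hξ : complexify (fderiv ℝ ρ z) ξ ≠ 0) :
    complexify (fderiv ℝ ρ z) (tangentField ρ ξ h z) = 0 := by
  rw [tangentField, map_sub, map_smul, smul_eq_mul, mul_assoc, inv_mul_cancel₀ hξ, mul_one,
    sub_self]

theorem tangentField_of_complexify_eq_zero {ρ : CSpace m → ℝ} {ξ h z : CSpace m}
    (hh : complexify (fderiv ℝ ρ z) h = 0) : tangentField ρ ξ h z = h := by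
  rw [tangentField, hh, zero_mul, zero_smul, sub_zero]

theorem ContDiffAt.tangentField {ρ : CSpace m → ℝ} {ξ z : CSpace m} (hρ : ContDiffAt ℝ ∞ ρ z)
    (hξ : complexify (fderiv ℝ ρ z) ξ ≠ 0) (h : CSpace m) :
    ContDiffAt ℝ ∞ (tangentField ρ ξ h) z := by
  have hd : ContDiffAt ℝ ∞ (fderiv ℝ ρ) z := hρ.fderiv_right (by simp)
  have h1 : ContDiffAt ℝ ∞
      (fun x => complexify (fderiv ℝ ρ x) h * (complexify (fderiv ℝ ρ x) ξ)⁻¹) z :=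
    (hd.complexify_apply contDiffAt_const).mul
      ((hd.complexify_apply contDiffAt_const).inv hξ)
  exact contDiffAt_const.sub
    ((((ContinuousLinearMap.toSpanSingleton ℂ ξ).restrictScalars ℝ).contDiff.contDiffAt).comp z h1)

/-- The one-forms that cut out the Levi null spaces. -/
def leviRows (ρ : CSpace m → ℝ) (ξ : CSpace m) (h : Fin r → CSpace m) (z : CSpace m) :
    Fin (r + 1) → CSpace m →L[ℝ] ℝ :=
  Fin.cons (fderiv ℝ ρ z)
    fun j => oneFormDeriv (realCharForm ρ) z (tangentField ρ ξ (h j) z)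

theorem contDiffAt_leviRows {ρ : CSpace m → ℝ} {ξ z : CSpace m} (hρ : ContDiffAt ℝ ∞ ρ z)
    (hξ : complexify (fderiv ℝ ρ z) ξ ≠ 0) (h : Fin r → CSpace m) (j : Fin (r + 1)) :
    ContDiffAt ℝ ∞ (fun x => leviRows ρ ξ h x j) z := by
  refine Fin.cases ?_ (fun j => ?_) j
  · exact hρ.fderiv_right (by simp)
  · exact hρ.realCharForm.oneFormDeriv.clm_apply (hρ.tangentField hξ _)

theorem rowsMap_leviRows_eq_zero_iff {ρ : CSpace m → ℝ} {ξ : CSpace m} {h : Fin r → CSpace m}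
    {z v : CSpace m} : rowsMap (leviRows ρ ξ h z) v = 0 ↔ complexify (fderiv ℝ ρ z) v = 0 ∧
      ∀ j, complexify (oneFormDeriv (realCharForm ρ) z (tangentField ρ ξ (h j) z)) v = 0 := by
  rw [rowsMap_eq_zero_iff, Fin.forall_fin_succ]
  rfl

theorem mem_holTangent_iff {ρ : CSpace m → ℝ} {z v : CSpace m} :
    v ∈ holTangent ρ z ↔ complexify (fderiv ℝ ρ z) v = 0 :=
  complexify_eq_zero_iff.symm

theorem leviForm_apply (ρ : CSpace m → ℝ) (z : CSpace m) (w v : holTangent ρ z) :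
    leviForm ρ z w v = leviValue ρ z w v := rfl

/-- If the tangential part of the rows spans the range of the Levi form, the joint map of the rows
is onto. -/
theorem exists_surjective_leviRows {ρ : CSpace m → ℝ} {p : CSpace m} (hρ : ContDiffAt ℝ ∞ ρ p)
    (hrank : leviRank ρ p = r) {ξ : CSpace m} (hξ : complexify (fderiv ℝ ρ p) ξ ≠ 0) :
    ∃ h : Fin r → CSpace m, Function.Surjective (rowsMap (leviRows ρ ξ h p)) := by
  let b := Module.finBasisOfFinrankEq ℂ (LinearMap.range (leviForm ρ p)) hrank
  have hb : ∀ j, ∃ w, leviForm ρ p w = b j := fun j => (b j).2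
  choose w hw using hb
  refine ⟨fun j => w j, ?_⟩
  refine LinearMap.surjective_of_forall_sum_eq_zero (rowsMap _).toLinearMap fun a ha => ?_
  have hw0 : ∀ j, tangentField ρ ξ (w j) p = w j := fun j =>
    tangentField_of_complexify_eq_zero (mem_holTangent_iff.1 (w j).2)
  have ha' : ∀ v, a 0 * complexify (fderiv ℝ ρ p) v +
      ∑ j : Fin r, a j.succ * complexify (oneFormDeriv (realCharForm ρ) p (w j)) v = 0 := by
    intro v
    have h1 := ha v
    rw [Fin.sum_univ_succ] at h1
    simpa [rowsMap_apply, leviRows, hw0] using h1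
  -- On the complex tangent space the `∂ρ` row drops out, and a relation between basis elements of
  -- the range of the Levi form remains.
  have hsucc : ∀ j : Fin r, a j.succ = 0 := by
    have h1 : ∑ j : Fin r, a j.succ • b j = 0 := by
      refine Subtype.ext (LinearMap.ext fun v => ?_)
      have h2 := ha' v
      rw [mem_holTangent_iff.1 v.2, mul_zero, zero_add] at h2
      have h3 : ∀ j, complexify (oneFormDeriv (realCharForm ρ) p (w j)) v =
          4 * Complex.I * leviForm ρ p (w j) v := by
        intro j
        rw [leviForm_apply, leviValue_eq_complexify hρ]
        field_simp
      simp only [h3, hw] at h2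
      have h4 : 4 * Complex.I * ∑ j : Fin r, a j.succ * (b j : holTangent ρ p →ₗ[ℂ] ℂ) v = 0 := by
        rw [Finset.mul_sum, ← h2]
        exact Finset.sum_congr rfl fun j _ => by ring
      have h5 := (mul_eq_zero.1 h4).resolve_left (by simp)
      simpa [Submodule.coe_sum, LinearMap.sum_apply] using h5
    exact Fintype.linearIndependent_iff.1 b.linearIndependent _ h1
  -- The vector `ξ` is transverse to the complex tangent space, so it detects the `∂ρ` row.
  have h0 : a 0 = 0 := by
    have h1 := ha' ξ
    simp only [hsucc, zero_mul, Finset.sum_const_zero, add_zero] at h1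
    exact (mul_eq_zero.1 h1).resolve_right hξ
  ext j
  exact Fin.cases h0 hsucc j

/-- Where the rows are independent and the Levi form has rank `r`, their common kernel is the null
space of the Levi form. -/
theorem oneFormDeriv_eq_zero_of_rowsMap_eq_zero {ρ : CSpace m → ℝ} {z ξ : CSpace m}
    (hρ : ContDiffAt ℝ ∞ ρ z) (hrank : leviRank ρ z = r)
    (hξ : complexify (fderiv ℝ ρ z) ξ ≠ 0) {h : Fin r → CSpace m}
    (hsurj : Function.Surjective (rowsMap (leviRows ρ ξ h z))) {v : CSpace m}
    (hv : rowsMap (leviRows ρ ξ h z) v = 0) {w : CSpace m}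
    (hw : complexify (fderiv ℝ ρ z) w = 0) : oneFormDeriv (realCharForm ρ) z v w = 0 := by
  rw [rowsMap_leviRows_eq_zero_iff] at hv
  let e : Fin r → holTangent ρ z := fun j =>
    ⟨tangentField ρ ξ (h j) z, mem_holTangent_iff.2 (complexify_tangentField hξ)⟩
  have hval : ∀ (j : Fin r) (u : holTangent ρ z), leviForm ρ z (e j) u =
      1 / (4 * Complex.I) * rowsMap (leviRows ρ ξ h z) u j.succ := by
    intro j u
    rw [leviForm_apply, leviValue_eq_complexify hρ]
    rfl
  -- Surjectivity gives a vector dual to row `k.succ`; its row `0` vanishes, so it is complex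
  -- tangent.
  have hind : LinearIndependent ℂ fun j => leviForm ρ z (e j) := by
    rw [Fintype.linearIndependent_iff]
    intro a ha k
    obtain ⟨u, hu⟩ := hsurj (EuclideanSpace.single k.succ 1)
    have hu0 : u ∈ holTangent ρ z := by
      rw [mem_holTangent_iff]
      have := congrArg (fun y : CSpace (r + 1) => y 0) hu
      simpa [rowsMap_apply, leviRows, (Fin.succ_ne_zero k).symm] using this
    have h1 := congrArg (fun L : holTangent ρ z →ₗ[ℂ] ℂ => L ⟨u, hu0⟩) ha
    simp only [LinearMap.sum_apply, LinearMap.smul_apply, hval, hu, LinearMap.zero_apply] at h1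
    simpa [PiLp.single_apply, Fin.succ_inj] using h1
  -- Here the constant rank enters: `r` independent functionals in the `r`-dimensional range span
  -- it, so a vector killed by the rows is killed by the whole Levi form.
  have hspan : Submodule.span ℂ (Set.range fun j => leviForm ρ z (e j)) =
      LinearMap.range (leviForm ρ z) := by
    refine Submodule.eq_of_le_of_finrank_eq ?_ ?_
    · rw [Submodule.span_le]
      rintro _ ⟨j, rfl⟩
      exact LinearMap.mem_range_self _ _
    · rw [finrank_span_eq_card hind, Fintype.card_fin]
      exact hrank.symm
  have hvH : v ∈ holTangent ρ z := mem_holTangent_iff.2 hv.1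
  have hker : ∀ L ∈ LinearMap.range (leviForm ρ z), L ⟨v, hvH⟩ = 0 := by
    intro L hL
    rw [← hspan] at hL
    induction hL using Submodule.span_induction with
    | mem L hL =>
      obtain ⟨j, rfl⟩ := hL
      simp only [leviForm_apply, leviValue_eq_complexify hρ]
      rw [hv.2 j, mul_zero]
    | zero => rfl
    | add L L' _ _ h1 h2 => rw [LinearMap.add_apply, h1, h2, add_zero]
    | smul a L _ h1 => rw [LinearMap.smul_apply, h1, smul_zero]
  have h1 := hker _ (LinearMap.mem_range_self (leviForm ρ z) ⟨w, mem_holTangent_iff.2 hw⟩)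
  rw [leviForm_apply, leviValue_eq_complexify hρ] at h1
  have h2 := (mul_eq_zero.1 h1).resolve_left (by simp)
  rw [oneFormDeriv_swap, (complexify_eq_zero_iff.1 h2).1, neg_zero]

/-- The bracket of two vector fields in the common kernel of the rows is again in the kernel, along
the zero set of `ρ`. -/
theorem rowsMap_bracket_eq_zero {ρ : CSpace m → ℝ} {V : Set (CSpace m)} (hV : IsOpen V)
    (hρ : ContDiffOn ℝ ∞ ρ V) (hrank : ∀ z ∈ V, ρ z = 0 → leviRank ρ z = r) {ξ : CSpace m}
    (hξ : ∀ z ∈ V, complexify (fderiv ℝ ρ z) ξ ≠ 0) {h : Fin r → CSpace m}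
    (hsurj : ∀ z ∈ V, Function.Surjective (rowsMap (leviRows ρ ξ h z))) {z : CSpace m}
    (hz : z ∈ V) (hz0 : ρ z = 0) {V₁ V₂ : CSpace m → CSpace m} (hV₁ : ContDiffAt ℝ ∞ V₁ z)
    (hV₂ : ContDiffAt ℝ ∞ V₂ z)
    (hS₁ : ∀ᶠ x in 𝓝 z, rowsMap (leviRows ρ ξ h x) (V₁ x) = 0)
    (hS₂ : ∀ᶠ x in 𝓝 z, rowsMap (leviRows ρ ξ h x) (V₂ x) = 0) :
    rowsMap (leviRows ρ ξ h z) (fderiv ℝ V₂ z (V₁ z) - fderiv ℝ V₁ z (V₂ z)) = 0 := by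
  have hVn : ∀ᶠ x in 𝓝 z, x ∈ V := hV.mem_nhds hz
  have hρa : ∀ x ∈ V, ContDiffAt ℝ ∞ ρ x := fun x hx => hρ.contDiffAt (hV.mem_nhds hx)
  have hρz := hρa z hz
  have hρ0 : fderiv ℝ ρ z ≠ 0 := by
    intro h0
    refine hξ z hz ?_
    rw [complexify_apply, h0]
    simp
  have hd : ∀ {X : CSpace m → CSpace m},
      (∀ᶠ x in 𝓝 z, rowsMap (leviRows ρ ξ h x) (X x) = 0) →
        (∀ᶠ x in 𝓝 z, fderiv ℝ ρ x (X x) = 0) ∧ ∀ᶠ x in 𝓝 z, realCharForm ρ x (X x) = 0 :=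
    fun hX => ⟨hX.mono fun x hx =>
        (complexify_eq_zero_iff.1 (rowsMap_leviRows_eq_zero_iff.1 hx).1).1,
      hX.mono fun x hx => (complexify_eq_zero_iff.1 (rowsMap_leviRows_eq_zero_iff.1 hx).1).2⟩
  -- The rank is known only on `{ρ = 0}`, so off it the kernel of the rows need not be Levi null.
  have hnull : ∀ {X : CSpace m → CSpace m},
      (∀ᶠ x in 𝓝 z, rowsMap (leviRows ρ ξ h x) (X x) = 0) →
        ∀ᶠ x in 𝓝 z, ρ x = ρ z → ∀ v, fderiv ℝ ρ x v = 0 → realCharForm ρ x v = 0 →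
          oneFormDeriv (realCharForm ρ) x (X x) v = 0 := by
    intro X hX
    filter_upwards [hX, hVn] with x hx hxV hxz v hv1 hv2
    exact oneFormDeriv_eq_zero_of_rowsMap_eq_zero (hρa x hxV) (hrank x hxV (hxz.trans hz0))
      (hξ x hxV) (hsurj x hxV) hx (complexify_eq_zero_iff.2 ⟨hv1, hv2⟩)
  have hdρ : ContDiffAt ℝ ∞ (fderiv ℝ ρ) z := hρz.fderiv_right (by simp)
  have h2le : (2 : WithTop ℕ∞) ≤ ∞ := WithTop.coe_le_coe.2 (le_top : (2 : ℕ∞) ≤ ⊤)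
  have hsymmρ : ∀ a b, fderiv ℝ (fderiv ℝ ρ) z a b = fderiv ℝ (fderiv ℝ ρ) z b a := fun a b =>
    (hρz.isSymmSndFDerivAt (by rw [minSmoothness_of_isRCLikeNormedField]; exact h2le)) a b
  have hdV₁ := hV₁.differentiableAt (by simp)
  have hdV₂ := hV₂.differentiableAt (by simp)
  rw [rowsMap_leviRows_eq_zero_iff]
  constructor
  · rw [complexify_eq_zero_iff]
    constructor
    · rw [apply_bracket_eq (hdρ.differentiableAt (by simp)) hdV₁ hdV₂ (hd hS₁).1 (hd hS₂).1,
        oneFormDeriv_apply, hsymmρ, sub_self, neg_zero]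
    · rw [← realCharForm_apply, apply_bracket_eq (hρz.realCharForm.differentiableAt (by simp))
        hdV₁ hdV₂ (hd hS₁).2 (hd hS₂).2, (hnull hS₁).self_of_nhds rfl _
        (hd hS₂).1.self_of_nhds (hd hS₂).2.self_of_nhds, neg_zero]
  · intro j
    have hfield : ∀ᶠ x in 𝓝 z, complexify (fderiv ℝ ρ x) (tangentField ρ ξ (h j) x) = 0 :=
      hVn.mono fun x hx => complexify_tangentField (hξ x hx)
    have hfield' : ∀ᶠ x in 𝓝 z,
        complexify (fderiv ℝ ρ x) (Complex.I • tangentField ρ ξ (h j) x) = 0 :=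
      hfield.mono fun x hx => by rw [map_smul, hx, smul_zero]
    have hsm : ContDiffAt ℝ ∞ (tangentField ρ ξ (h j)) z := hρz.tangentField (hξ z hz) _
    have hsm' : ContDiffAt ℝ ∞ (fun x => Complex.I • tangentField ρ ξ (h j) x) z :=
      (mulI m).contDiff.contDiffAt.comp z hsm
    -- To be used for `W = T` and `W = i T`, with `T` the tangent field of the row: together they
    -- give the vanishing of the complexified row.
    have key : ∀ {W : CSpace m → CSpace m}, ContDiffAt ℝ ∞ W z →
        (∀ᶠ x in 𝓝 z, complexify (fderiv ℝ ρ x) (W x) = 0) →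
        oneFormDeriv (realCharForm ρ) z (fderiv ℝ V₂ z (V₁ z) - fderiv ℝ V₁ z (V₂ z)) (W z) = 0 :=
      fun hW hW0 => oneFormDeriv_bracket_eq_zero hρz hρ0 hρz.realCharForm hV₁ hV₂ hW
        (hd hS₁).1 (hd hS₂).1 (hW0.mono fun x hx => (complexify_eq_zero_iff.1 hx).1)
        (hd hS₁).2 (hd hS₂).2 (hW0.mono fun x hx => (complexify_eq_zero_iff.1 hx).2)
        (hnull hS₁) (hnull hS₂)
    rw [complexify_eq_zero_iff]
    constructor
    · rw [oneFormDeriv_swap, key hsm hfield, neg_zero]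
    · rw [← oneFormDeriv_I_smul_I_smul hρz, I_smul_I_smul, map_neg, oneFormDeriv_swap,
        key hsm' hfield', neg_zero, neg_zero]

/-- Near a point of a Levi uniform hypersurface, the Levi null spaces are the kernels of a smooth
family of surjective complex linear maps, and these kernels are involutive along the hypersurface. -/
theorem exists_involutive_leviRows {ρ : CSpace m → ℝ} {U : Set (CSpace m)} (hU : IsOpen U)
    (hρ : ContDiffOn ℝ ∞ ρ U) (hρ0 : ∀ z ∈ U, fderiv ℝ ρ z ≠ 0) {p : CSpace m} (hp : p ∈ U)
    (hp0 : ρ p = 0) (hrank : ∀ z ∈ U, ρ z = 0 → leviRank ρ z = r) :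
    ∃ V : Set (CSpace m), IsOpen V ∧ p ∈ V ∧ V ⊆ U ∧
      ∃ S : CSpace m → CSpace m →L[ℂ] CSpace (r + 1),
        ContDiffOn ℝ ∞ (fun z => (S z).restrictScalars ℝ) V ∧
        (∀ z ∈ V, Function.Surjective (S z)) ∧
        (∀ z v, S z v = 0 → fderiv ℝ ρ z v = 0) ∧
        ∀ z ∈ V, ρ z = 0 → ∀ V₁ V₂ : CSpace m → CSpace m, ContDiffAt ℝ ∞ V₁ z →
          ContDiffAt ℝ ∞ V₂ z → (∀ᶠ x in 𝓝 z, S x (V₁ x) = 0) → (∀ᶠ x in 𝓝 z, S x (V₂ x) = 0) →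
          S z (fderiv ℝ V₂ z (V₁ z) - fderiv ℝ V₁ z (V₂ z)) = 0 := by
  have hρa : ∀ x ∈ U, ContDiffAt ℝ ∞ ρ x := fun x hx => hρ.contDiffAt (hU.mem_nhds hx)
  obtain ⟨ξ, hξ⟩ := complexify_ne_zero (hρ0 p hp)
  obtain ⟨h, hh⟩ := exists_surjective_leviRows (hρa p hp) (hrank p hp hp0) hξ
  let S : CSpace m → CSpace m →L[ℂ] CSpace (r + 1) := fun z => rowsMap (leviRows ρ ξ h z)
  let U₁ : Set (CSpace m) := U ∩ (fun z => complexify (fderiv ℝ ρ z) ξ) ⁻¹' {0}ᶜ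
  have hU₁ : IsOpen U₁ := by
    refine ContinuousOn.isOpen_inter_preimage (fun z hz => ?_) hU isOpen_compl_singleton
    exact (((hρa z hz).fderiv_right (m := ∞) (by simp)).complexify_apply
      contDiffAt_const).continuousAt.continuousWithinAt
  have hS₁ : ContDiffOn ℝ ∞ (fun z => (S z).restrictScalars ℝ) U₁ :=
    contDiffOn_rowsMap hU₁ fun j z hz =>
      (contDiffAt_leviRows (hρa z hz.1) hz.2 h j).contDiffWithinAt
  obtain ⟨σ, hσ⟩ := (S p).toLinearMap.exists_rightInverse_of_surjective
    (LinearMap.range_eq_top.2 hh)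
  let σ' : CSpace (r + 1) →L[ℝ] CSpace m := (LinearMap.toContinuousLinearMap σ).restrictScalars ℝ
  -- Surjectivity persists near `p` because `S z ∘ σ'` is the identity at `p` and invertibility is
  -- an open condition.
  let U₂ : Set (CSpace m) := U₁ ∩ (fun z => ((S z).restrictScalars ℝ).comp σ') ⁻¹'
    Set.range ((↑) : (CSpace (r + 1) ≃L[ℝ] CSpace (r + 1)) → CSpace (r + 1) →L[ℝ] CSpace (r + 1))
  have hU₂ : IsOpen U₂ :=
    (hS₁.continuousOn.clm_comp continuousOn_const).isOpen_inter_preimage hU₁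
      ContinuousLinearEquiv.isOpen
  have hpU₂ : p ∈ U₂ := by
    refine ⟨⟨hp, hξ⟩, ContinuousLinearEquiv.refl ℝ _, ?_⟩
    ext1 y
    exact (LinearMap.congr_fun hσ y).symm
  have hsurj : ∀ z ∈ U₂, Function.Surjective (S z) := by
    rintro z ⟨-, g, hg⟩ y
    refine ⟨σ' (g.symm y), ?_⟩
    have := congrArg (fun L : CSpace (r + 1) →L[ℝ] CSpace (r + 1) => L (g.symm y)) hg
    simpa using this.symm
  have hsub : U₂ ⊆ U := fun z hz => hz.1.1
  refine ⟨U₂, hU₂, hpU₂, hsub, S, hS₁.mono fun z hz => hz.1, hsurj, fun z v hv => ?_, ?_⟩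
  · exact (complexify_eq_zero_iff.1 (rowsMap_leviRows_eq_zero_iff.1 hv).1).1
  · intro z hz hz0 V₁ V₂ hV₁ hV₂ h1 h2
    exact rowsMap_bracket_eq_zero hU₂ (hρ.mono hsub) (fun z hz => hrank z (hsub hz))
      (fun z hz => hz.1.2) hsurj hz hz0 hV₁ hV₂ h1 h2

end NullFrame

/-! ### The null spaces as graphs and their integrability condition. -/

section LeafMap

/-- A smooth germ on a finite-dimensional space is the germ of a globally smooth map. -/
theorem ContDiffOn.exists_contDiff_eventuallyEq {E F : Type*} [NormedAddCommGroup E]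
    [NormedSpace ℝ E] [FiniteDimensional ℝ E] [NormedAddCommGroup F] [NormedSpace ℝ F] {f : E → F}
    {W : Set E} {p : E} (hf : ContDiffOn ℝ ∞ f W) (hW : IsOpen W) (hp : p ∈ W) :
    ∃ g : E → F, ContDiff ℝ ∞ g ∧ g =ᶠ[𝓝 p] f := by
  obtain ⟨R, hR, hRW⟩ := Metric.nhds_basis_closedBall.mem_iff.1 (hW.mem_nhds hp)
  let φ : ContDiffBump p := ⟨R / 2, R, by positivity, by linarith⟩
  refine ⟨fun x => φ x • f x, contDiff_iff_contDiffAt.2 fun x => ?_, ?_⟩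
  · by_cases hx : x ∈ Metric.closedBall p R
    · exact φ.contDiff.contDiffAt.smul (hf.contDiffAt (hW.mem_nhds (hRW hx)))
    · refine (contDiffAt_const (c := (0 : F))).congr_of_eventuallyEq ?_
      filter_upwards [Metric.isClosed_closedBall.isOpen_compl.mem_nhds hx] with y hy
      have : φ y = 0 := φ.zero_of_le_dist (by
        rw [Set.mem_compl_iff, Metric.mem_closedBall, not_le] at hy
        exact hy.le)
      rw [this, zero_smul]
  · filter_upwards [φ.eventuallyEq_one] with x hx
    rw [hx, Pi.one_apply, one_smul]

variable {m c d : ℕ}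

theorem ContinuousLinearMap.exists_equiv_prod_of_surjective (T : CSpace m →L[ℂ] CSpace c)
    (hT : Function.Surjective T) (hd : d + c = m) :
    ∃ e : (CSpace d × CSpace c) ≃L[ℂ] CSpace m, ∀ q, T (e q) = q.2 := by
  obtain ⟨σ, hσ⟩ := T.toLinearMap.exists_rightInverse_of_surjective (LinearMap.range_eq_top.2 hT)
  have hσ' : ∀ y, T (σ y) = y := fun y => LinearMap.congr_fun hσ y
  have hfin : Module.finrank ℂ (CSpace d) = Module.finrank ℂ (LinearMap.ker T.toLinearMap) := by
    have h1 := T.toLinearMap.finrank_range_add_finrank_ker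
    rw [LinearMap.range_eq_top.2 hT, finrank_top] at h1
    simp only [finrank_euclideanSpace_fin] at h1 ⊢
    omega
  let κ := LinearEquiv.ofFinrankEq (CSpace d) (LinearMap.ker T.toLinearMap) hfin
  have hκ : ∀ x, T (κ x) = 0 := fun x => (κ x).2
  let g : (CSpace d × CSpace c) →ₗ[ℂ] CSpace m :=
    ((LinearMap.ker T.toLinearMap).subtype.comp κ.toLinearMap).coprod σ
  have hg : ∀ q, g q = κ q.1 + σ q.2 := fun q => rfl
  have hTg : ∀ q, T (g q) = q.2 := fun q => by rw [hg, map_add, hκ, hσ', zero_add]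
  have hinj : Function.Injective g := by
    rw [← LinearMap.ker_eq_bot, LinearMap.ker_eq_bot']
    intro q hq
    have h2 : q.2 = 0 := by rw [← hTg, hq, map_zero]
    have h1 : κ q.1 = 0 := by
      rw [hg, h2, map_zero, add_zero] at hq
      exact Subtype.ext hq
    exact Prod.ext (κ.map_eq_zero_iff.1 h1) h2
  have hdim : Module.finrank ℂ (CSpace d × CSpace c) = Module.finrank ℂ (CSpace m) := by
    rw [Module.finrank_prod]
    simp only [finrank_euclideanSpace_fin]
    exact hd
  exact ⟨(LinearEquiv.ofInjectiveOfFinrankEq g hinj hdim).toContinuousLinearEquiv, hTg⟩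

/-- Near a point, a smooth family of kernels is the family of graphs of a smooth family of complex
linear maps. -/
theorem exists_graph_map {S : CSpace m → CSpace m →L[ℂ] CSpace c} {V : Set (CSpace m)}
    (hV : IsOpen V) (hS : ContDiffOn ℝ ∞ (fun z => (S z).restrictScalars ℝ) V) {p : CSpace m}
    (hp : p ∈ V) (e : (CSpace d × CSpace c) ≃L[ℂ] CSpace m) (he : ∀ q, S p (e q) = q.2) :
    ∃ A : CSpace d × CSpace c → CSpace d →L[ℝ] CSpace c, ContDiff ℝ ∞ A ∧ A 0 = 0 ∧
      ∃ ε > 0, ∀ q ∈ Metric.ball (0 : CSpace d × CSpace c) ε, p + e q ∈ V ∧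
        (∀ u, S (p + e q) (e (u, A q u)) = 0) ∧ (∀ u, A q (Complex.I • u) = Complex.I • A q u) ∧
        ∀ y, S (p + e q) (e (0, y)) = 0 → y = 0 := by
  let eR : (CSpace d × CSpace c) →L[ℝ] CSpace m := e.toContinuousLinearMap.restrictScalars ℝ
  let W : Set (CSpace d × CSpace c) := (fun q => p + e q) ⁻¹' V
  have hW : IsOpen W := hV.preimage (by fun_prop)
  have hshift : ContDiff ℝ ∞ (fun q => p + e q) := contDiff_const.add eR.contDiff
  let T : CSpace d × CSpace c → (CSpace d × CSpace c) →L[ℝ] CSpace c :=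
    fun q => ((S (p + e q)).restrictScalars ℝ).comp eR
  have hT : ContDiffOn ℝ ∞ T W :=
    (hS.comp hshift.contDiffOn fun q hq => hq).clm_comp contDiffOn_const
  let TX : CSpace d × CSpace c → CSpace d →L[ℝ] CSpace c :=
    fun q => (T q).comp (ContinuousLinearMap.inl ℝ _ _)
  let TY : CSpace d × CSpace c → CSpace c →L[ℝ] CSpace c :=
    fun q => (T q).comp (ContinuousLinearMap.inr ℝ _ _)
  have hTX : ContDiffOn ℝ ∞ TX W := hT.clm_comp contDiffOn_const
  have hTY : ContDiffOn ℝ ∞ TY W := hT.clm_comp contDiffOn_const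
  let W' : Set (CSpace d × CSpace c) := W ∩ TY ⁻¹'
    Set.range ((↑) : (CSpace c ≃L[ℝ] CSpace c) → CSpace c →L[ℝ] CSpace c)
  have hW' : IsOpen W' := hTY.continuousOn.isOpen_inter_preimage hW ContinuousLinearEquiv.isOpen
  have h0W : (0 : CSpace d × CSpace c) ∈ W := by
    change p + e 0 ∈ V
    rwa [map_zero, add_zero]
  have hT0 : ∀ q, T 0 q = q.2 := fun q => by
    change S (p + e 0) (e q) = q.2
    rw [map_zero, add_zero, he]
  have h0 : (0 : CSpace d × CSpace c) ∈ W' := by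
    refine ⟨h0W, ContinuousLinearEquiv.refl ℝ _, ?_⟩
    ext1 y
    exact (hT0 (0, y)).symm
  -- The solution of `TX u + TY (A u) = 0`.
  let A₀ : CSpace d × CSpace c → CSpace d →L[ℝ] CSpace c :=
    fun q => -((TY q).inverse.comp (TX q))
  have hA₀ : ContDiffOn ℝ ∞ A₀ W' := by
    intro q hq
    obtain ⟨g, hg⟩ := hq.2
    have h1 : ContDiffAt ℝ ∞ (fun q => (TY q).inverse) q := by
      have h2 := contDiffAt_map_inverse (n := ∞) g
      rw [hg] at h2
      exact h2.comp q (hTY.contDiffAt (hW.mem_nhds hq.1))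
    exact (h1.clm_comp (hTX.contDiffAt (hW.mem_nhds hq.1))).neg.contDiffWithinAt
  -- The operators on curve spaces need an `A` defined and smooth everywhere; only its germ at `0`
  -- matters.
  obtain ⟨A, hA, hAA₀⟩ := hA₀.exists_contDiff_eventuallyEq hW' h0
  obtain ⟨ε, hε, hball⟩ := Metric.eventually_nhds_iff_ball.1
    (hAA₀.and (hW'.mem_nhds h0 : ∀ᶠ q in 𝓝 0, q ∈ W'))
  refine ⟨A, hA, ?_, ε, hε, fun q hq => ?_⟩
  · rw [hAA₀.self_of_nhds]
    have : TX 0 = 0 := by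
      ext1 x
      exact hT0 (x, 0)
    change -((TY 0).inverse.comp (TX 0)) = 0
    rw [this, ContinuousLinearMap.comp_zero, neg_zero]
  · obtain ⟨hqA, hqW, g, hg⟩ := hball q hq
    have hker : ∀ u, S (p + e q) (e (u, A q u)) = 0 := by
      intro u
      change T q (u, A q u) = 0
      have h1 : ((u, A q u) : CSpace d × CSpace c) = (u, 0) + (0, A q u) := by simp
      have h2 : T q (0, A q u) = TY q (A₀ q u) := by rw [hqA]; rfl
      have h3 : TY q (A₀ q u) = -TX q u := by
        change TY q (-((TY q).inverse (TX q u))) = _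
        rw [map_neg, ← hg, ContinuousLinearMap.inverse_equiv]
        simp
      rw [h1, map_add, h2, h3]
      exact add_neg_cancel _
    have hinj : ∀ y, S (p + e q) (e (0, y)) = 0 → y = 0 := by
      intro y hy
      have h1 : TY q y = 0 := hy
      rw [← hg] at h1
      exact (map_eq_zero_iff g g.injective).1 h1
    refine ⟨hqW, hker, fun u => ?_, hinj⟩
    -- The kernel is a complex subspace containing `(i u, A (i u))` and `i (u, A u)`. Their
    -- difference is vertical, hence zero.
    rw [← sub_eq_zero]
    apply hinj
    have h1 : ((0 : CSpace d), A q (Complex.I • u) - Complex.I • A q u) =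
        (Complex.I • u, A q (Complex.I • u)) - Complex.I • (u, A q u) := by simp
    rw [h1, map_sub, map_sub, hker, map_smul, map_smul, hker, smul_zero, sub_zero]

/-- Involutivity of the kernels in terms of the family of graphs. -/
theorem graph_map_integrable {S : CSpace m → CSpace m →L[ℂ] CSpace c} {p : CSpace m}
    (e : (CSpace d × CSpace c) ≃L[ℂ] CSpace m)
    {A : CSpace d × CSpace c → CSpace d →L[ℝ] CSpace c} (hA : ContDiff ℝ ∞ A) {ε : ℝ}
    (hker : ∀ q ∈ Metric.ball (0 : CSpace d × CSpace c) ε, ∀ u, S (p + e q) (e (u, A q u)) = 0)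
    {q : CSpace d × CSpace c} (hq : q ∈ Metric.ball (0 : CSpace d × CSpace c) ε)
    (hinj : ∀ y, S (p + e q) (e (0, y)) = 0 → y = 0)
    (hinv : ∀ V₁ V₂ : CSpace m → CSpace m, ContDiffAt ℝ ∞ V₁ (p + e q) →
      ContDiffAt ℝ ∞ V₂ (p + e q) → (∀ᶠ x in 𝓝 (p + e q), S x (V₁ x) = 0) →
      (∀ᶠ x in 𝓝 (p + e q), S x (V₂ x) = 0) →
      S (p + e q) (fderiv ℝ V₂ (p + e q) (V₁ (p + e q)) -
        fderiv ℝ V₁ (p + e q) (V₂ (p + e q))) = 0) (u v : CSpace d) :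
    fderiv ℝ A q (u, A q u) v = fderiv ℝ A q (v, A q v) u := by
  let eR : (CSpace d × CSpace c) →L[ℝ] CSpace m := e.toContinuousLinearMap.restrictScalars ℝ
  let eRs : CSpace m →L[ℝ] (CSpace d × CSpace c) := e.symm.toContinuousLinearMap.restrictScalars ℝ
  let κ : CSpace m → CSpace d × CSpace c := fun z => eRs (z - p)
  have hκq : κ (p + e q) = q := by
    change e.symm (p + e q - p) = q
    rw [add_sub_cancel_left, e.symm_apply_apply]
  have hκ' : ∀ z, p + e (κ z) = z := fun z => by
    change p + e (e.symm (z - p)) = z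
    rw [e.apply_symm_apply, add_sub_cancel]
  have hκs : ContDiff ℝ ∞ κ := eRs.contDiff.comp (contDiff_id.sub contDiff_const)
  have hκd : HasFDerivAt κ eRs (p + e q) :=
    eRs.hasFDerivAt.comp (p + e q) ((hasFDerivAt_id (p + e q)).sub_const p)
  -- The lift of the constant field `u` to the kernels. The horizontal components are constant, so
  -- the bracket of two lifts is vertical, and a vertical vector in the kernel is zero.
  let X : CSpace d → CSpace m → CSpace m := fun u z => eR (u, A (κ z) u)
  have hX : ∀ u, ContDiff ℝ ∞ (X u) := fun u =>
    eR.contDiff.comp (contDiff_const.prodMk ((hA.comp hκs).clm_apply contDiff_const))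
  have hXS : ∀ u, ∀ᶠ x in 𝓝 (p + e q), S x (X u x) = 0 := by
    intro u
    have hnear : ∀ᶠ x in 𝓝 (p + e q), κ x ∈ Metric.ball (0 : CSpace d × CSpace c) ε :=
      hκs.continuous.continuousAt.preimage_mem_nhds
        (by rw [hκq]; exact Metric.isOpen_ball.mem_nhds hq)
    filter_upwards [hnear] with x hx
    have := hker _ hx u
    rw [hκ'] at this
    exact this
  have hXd : ∀ u w, fderiv ℝ (X u) (p + e q) w = e (0, fderiv ℝ A q (eRs w) u) := by
    intro u w
    have h1 : HasFDerivAt A (fderiv ℝ A q) (κ (p + e q)) := by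
      rw [hκq]; exact (hA.differentiable (by simp) q).hasFDerivAt
    have h2 : HasFDerivAt (fun z => A (κ z)) ((fderiv ℝ A q).comp eRs) (p + e q) :=
      h1.comp (p + e q) hκd
    have h3 : HasFDerivAt (X u) _ (p + e q) :=
      eR.hasFDerivAt.comp (p + e q) ((hasFDerivAt_const u (p + e q)).prodMk
        (h2.clm_apply (hasFDerivAt_const u (p + e q))))
    rw [h3.fderiv]
    change eR _ = eR _
    simp
  have hXq : ∀ u, eRs (X u (p + e q)) = (u, A q u) := fun u => by
    change e.symm (e (u, A (κ (p + e q)) u)) = _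
    rw [e.symm_apply_apply, hκq]
  have h1 := hinv (X u) (X v) (hX u).contDiffAt (hX v).contDiffAt (hXS u) (hXS v)
  rw [hXd, hXd, hXq, hXq, ← map_sub, Prod.mk_sub_mk, sub_zero] at h1
  exact sub_eq_zero.1 (hinj _ h1)

end LeafMap

/-! ### The leaves, their complex structure and transverse coordinates. -/

section LeviFoliation

variable {m r d : ℕ}

/-- The leaves of the Levi foliation as graphs `y = f(x, y₀)` in linear coordinates adapted to the
Levi null space at `p`. -/
theorem exists_leaf_map {ρ : CSpace m → ℝ} {U : Set (CSpace m)} (hU : IsOpen U)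
    (hρ : ContDiffOn ℝ ∞ ρ U) (hρ0 : ∀ z ∈ U, fderiv ℝ ρ z ≠ 0) {p : CSpace m} (hp : p ∈ U)
    (hp0 : ρ p = 0) (hrank : ∀ z ∈ U, ρ z = 0 → leviRank ρ z = r) (hd : d + (r + 1) = m) :
    ∃ (e : (CSpace d × CSpace (r + 1)) ≃L[ℂ] CSpace m)
      (f : CSpace d × CSpace (r + 1) → CSpace (r + 1)) (δ : ℝ), 0 < δ ∧
      (∀ u, fderiv ℝ ρ p (e (u, 0)) = 0) ∧
      ContDiffOn ℝ ∞ f (Metric.ball 0 δ) ∧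
      HasFDerivAt f (ContinuousLinearMap.snd ℝ (CSpace d) (CSpace (r + 1))) 0 ∧
      (∀ y ∈ Metric.ball (0 : CSpace (r + 1)) δ, f (0, y) = y) ∧
      (∀ q ∈ Metric.ball (0 : CSpace d × CSpace (r + 1)) δ,
        p + e (q.1, f q) ∈ U ∧ ρ (p + e (q.1, f q)) = ρ (p + e (0, q.2))) ∧
      ∀ q ∈ Metric.ball (0 : CSpace d × CSpace (r + 1)) δ, ρ (p + e (0, q.2)) = 0 →
        ∀ u, fderiv ℝ f q (Complex.I • u, 0) = Complex.I • fderiv ℝ f q (u, 0) := by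
  obtain ⟨V, hV, hpV, hVU, S, hS, hsurj, hSρ, hinv⟩ :=
    exists_involutive_leviRows hU hρ hρ0 hp hp0 hrank
  obtain ⟨e, he⟩ := (S p).exists_equiv_prod_of_surjective (hsurj p hpV) hd
  obtain ⟨A, hA, hA0, ε, hε, hAε⟩ := exists_graph_map hV hS hpV e he
  obtain ⟨δ₀, hδ₀, f, hf, hf0, hfrad⟩ := exists_radial_solution A hA hA0
  let eR : (CSpace d × CSpace (r + 1)) →L[ℝ] CSpace m := e.toContinuousLinearMap.restrictScalars ℝ
  have hfc : ContinuousAt f 0 :=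
    (hf.contDiffAt (Metric.ball_mem_nhds _ hδ₀)).continuousAt
  have hf00 : f 0 = 0 := hf0 0 (Metric.mem_ball_self hδ₀)
  have hnear : ∀ᶠ q in 𝓝 (0 : CSpace d × CSpace (r + 1)),
      (q.1, f q) ∈ Metric.ball (0 : CSpace d × CSpace (r + 1)) ε := by
    have hc : ContinuousAt (fun q : CSpace d × CSpace (r + 1) => (q.1, f q)) 0 :=
      continuousAt_fst.prodMk hfc
    refine hc.preimage_mem_nhds (Metric.isOpen_ball.mem_nhds ?_)
    rw [hf00]
    exact Metric.mem_ball_self hε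
  obtain ⟨δ, hδ, hball⟩ := Metric.eventually_nhds_iff_ball.1
    (hnear.and (Metric.ball_mem_nhds _ hδ₀ : ∀ᶠ q in 𝓝 (0 : CSpace d × CSpace (r + 1)),
      q ∈ Metric.ball (0 : CSpace d × CSpace (r + 1)) δ₀))
  have hpair : ∀ {x : CSpace d} {y : CSpace (r + 1)},
      (x, y) ∈ Metric.ball (0 : CSpace d × CSpace (r + 1)) δ ↔
        x ∈ Metric.ball (0 : CSpace d) δ ∧ y ∈ Metric.ball (0 : CSpace (r + 1)) δ := by
    intro x y
    simp only [mem_ball_zero_iff, Prod.norm_def, max_lt_iff]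
  have hfat : ∀ q ∈ Metric.ball (0 : CSpace d × CSpace (r + 1)) δ, ContDiffAt ℝ ∞ f q :=
    fun q hq => hf.contDiffAt (Metric.isOpen_ball.mem_nhds (hball q hq).2)
  have hf0' : ∀ y ∈ Metric.ball (0 : CSpace (r + 1)) δ, f (0, y) = y := fun y hy =>
    hf0 y (hball _ (hpair.2 ⟨Metric.mem_ball_self hδ, hy⟩)).2
  -- The radial curves are tangent to `ker S ⊆ ker dρ` also off the hypersurface, so `ρ` is constant
  -- along every one of them.
  have hlevel : ∀ q ∈ Metric.ball (0 : CSpace d × CSpace (r + 1)) δ,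
      p + e (q.1, f q) ∈ U ∧ ρ (p + e (q.1, f q)) = ρ (p + e (0, q.2)) := by
    rintro ⟨x, y⟩ hq
    obtain ⟨hx, hy⟩ := hpair.1 hq
    have hmem : ∀ t ∈ Set.Icc (0 : ℝ) 1,
        (t • x, y) ∈ Metric.ball (0 : CSpace d × CSpace (r + 1)) δ := fun t ht =>
      hpair.2 ⟨smul_mem_ball_zero hx ht, hy⟩
    have hder : ∀ t ∈ Set.Icc (0 : ℝ) 1, HasDerivWithinAt
        (fun s : ℝ => ρ (p + e (s • x, f (s • x, y)))) 0 (Set.Icc (0 : ℝ) 1) t := by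
      intro t ht
      obtain ⟨h1, h2, -, -⟩ := hAε _ (hball _ (hmem t ht)).1
      have hline : HasDerivWithinAt (fun s : ℝ => s • x) x (Set.Icc (0 : ℝ) 1) t := by
        simpa using ((hasDerivAt_id t).smul_const x).hasDerivWithinAt
      have h3 : HasDerivWithinAt (fun s : ℝ => p + eR (s • x, f (s • x, y)))
          (eR (x, A (t • x, f (t • x, y)) x)) (Set.Icc (0 : ℝ) 1) t :=
        (eR.hasFDerivAt.comp_hasDerivWithinAt t
          (hline.prodMk (hfrad x y (hball _ hq).2 t ht))).const_add p
      have h4 : HasFDerivAt ρ (fderiv ℝ ρ (p + e (t • x, f (t • x, y))))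
          (p + eR (t • x, f (t • x, y))) :=
        ((hρ.contDiffAt (hU.mem_nhds (hVU h1))).differentiableAt (by simp)).hasFDerivAt
      have h5 := h4.comp_hasDerivWithinAt t h3
      have h6 : fderiv ℝ ρ (p + e (t • x, f (t • x, y))) (eR (x, A (t • x, f (t • x, y)) x)) = 0 :=
        hSρ _ _ (h2 x)
      rw [h6] at h5
      exact h5
    refine ⟨hVU (hAε _ (hball _ hq).1).1, ?_⟩
    have hconst := constant_of_derivWithin_zero (fun t ht => (hder t ht).differentiableWithinAt)
      (fun t ht => (hder t ⟨ht.1, ht.2.le⟩).derivWithin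
        (uniqueDiffOn_Icc_zero_one t ⟨ht.1, ht.2.le⟩)) 1 (Set.right_mem_Icc.2 zero_le_one)
    simp only [one_smul, zero_smul, hf0' y hy] at hconst
    exact hconst
  -- If the initial point satisfies `ρ = 0`, the whole graph does by `hlevel`; thus involutivity is
  -- available at all its points.
  have hfx : ∀ q ∈ Metric.ball (0 : CSpace d × CSpace (r + 1)) δ, ρ (p + e (0, q.2)) = 0 →
      ∀ u, fderiv ℝ f q (u, 0) = A (q.1, f q) u := by
    rintro ⟨x₀, y⟩ hq hy0 u
    obtain ⟨hx₀, hy⟩ := hpair.1 hq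
    let g : CSpace d → CSpace (r + 1) := fun x => f (x, y)
    have hmem : ∀ x ∈ Metric.ball (0 : CSpace d) δ,
        (x, y) ∈ Metric.ball (0 : CSpace d × CSpace (r + 1)) δ := fun x hx => hpair.2 ⟨hx, hy⟩
    have hgd : ∀ x ∈ Metric.ball (0 : CSpace d) δ,
        HasFDerivAt g ((fderiv ℝ f (x, y)).comp (ContinuousLinearMap.inl ℝ _ _)) x := fun x hx =>
      ((hfat _ (hmem x hx)).differentiableAt (by simp)).hasFDerivAt.comp x
        (hasFDerivAt_prodMk_left x y)
    have hgs : ContDiffOn ℝ ∞ g (Metric.ball 0 δ) := fun x hx =>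
      ((hfat _ (hmem x hx)).comp x
        (contDiffAt_id.prodMk contDiffAt_const)).contDiffWithinAt
    have key := fderiv_eq_of_radial A hA g hgs (fun x hx => ?_) (fun x hx u v => ?_) x₀ hx₀
    · rw [(hgd x₀ hx₀).fderiv] at key
      exact congrArg (fun L : CSpace d →L[ℝ] CSpace (r + 1) => L u) key
    · have h1 := hfrad x y (hball _ (hmem x hx)).2 1 (Set.right_mem_Icc.2 zero_le_one)
      rw [one_smul] at h1
      exact fderiv_self_eq_of_hasDerivWithinAt (hgd x hx).differentiableAt h1
    · have h1 := (hball _ (hmem x hx)).1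
      have h2 := hAε _ h1
      refine graph_map_integrable e hA (fun q hq => (hAε q hq).2.1) h1 h2.2.2.2 ?_ u v
      exact hinv _ h2.1 ((hlevel _ (hmem x hx)).2.trans hy0)
  refine ⟨e, f, δ, hδ, fun u => hSρ _ _ (he (u, 0)), fun q hq => (hfat q hq).contDiffWithinAt, ?_,
    hf0', hlevel, ?_⟩
  · have h0 : (0 : CSpace d × CSpace (r + 1)) ∈ Metric.ball (0 : CSpace d × CSpace (r + 1)) δ :=
      Metric.mem_ball_self hδ
    have h1 := ((hfat 0 h0).differentiableAt (by simp)).hasFDerivAt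
    refine h1.congr_fderiv (ContinuousLinearMap.ext fun q => ?_)
    -- The horizontal part of the derivative is `A 0 = 0`; the vertical part is the identity, from
    -- `f (0, y) = y`.
    have h2 : fderiv ℝ f 0 (q.1, 0) = 0 := by
      rw [hfx 0 h0 (by
        change ρ (p + e 0) = 0
        rw [map_zero, add_zero, hp0]), hf00]
      change A 0 q.1 = 0
      rw [hA0]; rfl
    have h3 : fderiv ℝ f 0 (0, q.2) = q.2 := by
      have h4 : HasFDerivAt (fun y => f (0, y))
          ((fderiv ℝ f 0).comp (ContinuousLinearMap.inr ℝ (CSpace d) (CSpace (r + 1)))) 0 :=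
        h1.comp (0 : CSpace (r + 1)) (hasFDerivAt_prodMk_right (0 : CSpace d) 0)
      have h5 := h4.congr_of_eventuallyEq (f₁ := fun y => y) (by
        filter_upwards [Metric.ball_mem_nhds _ hδ] with y hy using (hf0' y hy).symm)
      exact congrArg (fun L : CSpace (r + 1) →L[ℝ] CSpace (r + 1) => L q.2)
        (h5.unique (hasFDerivAt_id 0))
    have h6 : q = (q.1, 0) + (0, q.2) := by simp
    conv_lhs => rw [h6, map_add, h2, h3, zero_add]
    rfl
  · intro q hq hq0 u
    rw [hfx q hq hq0, hfx q hq hq0]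
    exact (hAε _ (hball q hq).1).2.2.1 u

/-- The functional becomes the last coordinate, and its kernel supplies the others through the
projection along `y₁`. -/
theorem exists_equiv_prod_of_functional {Y : Type*} [NormedAddCommGroup Y] [NormedSpace ℝ Y]
    [FiniteDimensional ℝ Y] {q : ℕ} (hq : Module.finrank ℝ Y = q + 1) (l : Y →L[ℝ] ℝ)
    (hl : l ≠ 0) : ∃ g : Y ≃L[ℝ] EuclideanSpace ℝ (Fin q) × ℝ, ∀ y, (g y).2 = l y := by
  obtain ⟨y₁, hy₁⟩ := DFunLike.ne_iff.1 hl
  have hy₁' : l y₁ ≠ 0 := hy₁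
  have hsurj : LinearMap.range l.toLinearMap = ⊤ := by
    rw [LinearMap.range_eq_top]
    intro s
    refine ⟨(s / l y₁) • y₁, ?_⟩
    simp [hy₁']
  have hfin : Module.finrank ℝ (LinearMap.ker l.toLinearMap) =
      Module.finrank ℝ (EuclideanSpace ℝ (Fin q)) := by
    have h1 := l.toLinearMap.finrank_range_add_finrank_ker
    rw [hsurj, finrank_top, Module.finrank_self, hq] at h1
    rw [finrank_euclideanSpace_fin]
    omega
  let κ := LinearEquiv.ofFinrankEq (LinearMap.ker l.toLinearMap) (EuclideanSpace ℝ (Fin q)) hfin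
  let π : Y →ₗ[ℝ] LinearMap.ker l.toLinearMap :=
    LinearMap.codRestrict _ (LinearMap.id - (l.toLinearMap.smulRight ((l y₁)⁻¹ • y₁))) fun y => by
      simp [hy₁']
  let g₀ : Y →ₗ[ℝ] EuclideanSpace ℝ (Fin q) × ℝ := (κ.toLinearMap.comp π).prod l.toLinearMap
  have hinj : Function.Injective g₀ := by
    rw [← LinearMap.ker_eq_bot, LinearMap.ker_eq_bot']
    intro y hy
    have h1 : κ (π y) = 0 := congrArg Prod.fst hy
    have h2 : l y = 0 := congrArg Prod.snd hy
    have h3 := congrArg Subtype.val (κ.map_eq_zero_iff.1 h1)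
    change y - l y • ((l y₁)⁻¹ • y₁) = 0 at h3
    rwa [h2, zero_smul, sub_zero] at h3
  have hdim : Module.finrank ℝ Y = Module.finrank ℝ (EuclideanSpace ℝ (Fin q) × ℝ) := by
    rw [Module.finrank_prod, finrank_euclideanSpace_fin, Module.finrank_self, hq]
  exact ⟨(LinearEquiv.ofInjectiveOfFinrankEq g₀ hinj hdim).toContinuousLinearEquiv, fun y => rfl⟩

/-- The graph of a map with complex linear differential is a complex submanifold. -/
theorem isComplexSubmanifold_of_graph {c : ℕ} (hd : d + c = m)
    (e : (CSpace d × CSpace c) ≃L[ℂ] CSpace m) (p : CSpace m) {N W : Set (CSpace m)}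
    (hW : IsOpen W) (hNW : N ⊆ W) {g : CSpace d → CSpace c}
    (hg : ∀ z ∈ W, DifferentiableAt ℝ g (e.symm (z - p)).1)
    (hgI : ∀ z ∈ W, ∀ u, fderiv ℝ g (e.symm (z - p)).1 (Complex.I • u) =
      Complex.I • fderiv ℝ g (e.symm (z - p)).1 u)
    (hN : ∀ z ∈ W, z ∈ N ↔ (e.symm (z - p)).2 = g (e.symm (z - p)).1) :
    IsComplexSubmanifold d N := by
  refine ⟨c, hd, fun z₀ hz₀ => ⟨W, fun z => (e.symm (z - p)).2 - g (e.symm (z - p)).1, hW, hNW hz₀,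
    ?_⟩⟩
  have hder : ∀ z ∈ W, ∃ L : CSpace d →L[ℂ] CSpace c,
      HasFDerivAt (fun z => (e.symm (z - p)).2 - g (e.symm (z - p)).1)
        ((ContinuousLinearMap.snd ℂ _ _).comp e.symm.toContinuousLinearMap -
          L.comp ((ContinuousLinearMap.fst ℂ _ _).comp e.symm.toContinuousLinearMap)) z := by
    intro z hz
    refine ⟨(fderiv ℝ g (e.symm (z - p)).1).toComplexLinear (hgI z hz), ?_⟩
    have h1 : HasFDerivAt g ((fderiv ℝ g (e.symm (z - p)).1).toComplexLinear (hgI z hz))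
        (e.symm (z - p)).1 :=
      hasFDerivAt_of_restrictScalars ℝ (hg z hz).hasFDerivAt rfl
    have h2 : HasFDerivAt (fun z => e.symm (z - p)) e.symm.toContinuousLinearMap z :=
      e.symm.hasFDerivAt.comp z ((hasFDerivAt_id z).sub_const p)
    exact h2.snd.sub (h1.comp z h2.fst)
  refine ⟨fun z hz => ?_, fun z hz y => ?_, ?_⟩
  · obtain ⟨L, hL⟩ := hder z hz
    exact hL.differentiableAt.differentiableWithinAt
  · obtain ⟨L, hL⟩ := hder z hz
    rw [hL.fderiv]
    exact ⟨e (0, y), by simp⟩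
  · ext z
    constructor
    · rintro ⟨h1, h2⟩
      exact ⟨h2, sub_eq_zero.2 ((hN z h2).1 h1)⟩
    · rintro ⟨h1, h2⟩
      exact ⟨(hN z h1).2 (sub_eq_zero.1 h2), h1⟩

end LeviFoliation

end

/-! ### The foliated chart. -/

theorem proposition1p15 (n r : ℕ) (hr : r < n)
    (M : Set (CSpace (n + 1))) (hM : IsRealHypersurface M)
    (p₀ : CSpace (n + 1)) (hp₀ : p₀ ∈ M) (hL : IsLeviUniformAt M p₀ r) :
    IsFoliatedByComplexManifoldsNear M p₀ (n - r) := by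
  obtain ⟨U, ρ, hpU, hdef, hrank⟩ := hL
  have hMU : ∀ z ∈ U, z ∈ M ↔ ρ z = 0 := by
    intro z hz
    have h := Set.ext_iff.1 hdef.inter_eq z
    exact ⟨fun hzM => (h.1 ⟨hzM, hz⟩).2, fun h0 => (h.2 ⟨hz, h0⟩).1⟩
  have hp0 : ρ p₀ = 0 := (hMU p₀ hpU).1 hp₀
  have hdim : (n - r) + (r + 1) = n + 1 := by omega
  obtain ⟨e, f, δ, hδ, heρ, hf, hf', hf0, hlevel, hfI⟩ := exists_leaf_map hdef.isOpen
    hdef.contDiffOn hdef.fderiv_ne_zero hpU hp0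
    (fun z hz hz0 => hrank z ⟨(hMU z hz).2 hz0, hz⟩) hdim
  let eR : (CSpace (n - r) × CSpace (r + 1)) ≃L[ℝ] CSpace (n + 1) :=
    { e.toLinearEquiv.restrictScalars ℝ with
      continuous_toFun := e.continuous
      continuous_invFun := e.symm.continuous }
  have hball0 : (0 : CSpace (n - r) × CSpace (r + 1)) ∈
      Metric.ball (0 : CSpace (n - r) × CSpace (r + 1)) δ := Metric.mem_ball_self hδ
  have hf00 : f 0 = 0 := hf0 0 (Metric.mem_ball_self hδ)
  -- This map straightens the leaves: the slices `y = const` with `ρ₀ y = 0` are sent into them. Its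
  -- derivative at `0` is `eR`.
  let Θ : CSpace (n - r) × CSpace (r + 1) → CSpace (n + 1) := fun q => p₀ + eR (q.1, f q)
  have hΘ : ContDiffOn ℝ ∞ Θ (Metric.ball 0 δ) :=
    contDiffOn_const.add (eR.contDiff.comp_contDiffOn (contDiffOn_fst.prodMk hf))
  have hΘ' : HasFDerivAt Θ (eR : _ →L[ℝ] CSpace (n + 1)) 0 := by
    have h1 := (eR.hasFDerivAt.comp (0 : CSpace (n - r) × CSpace (r + 1))
      (hasFDerivAt_fst.prodMk hf')).const_add p₀
    exact h1
  obtain ⟨eΘ, h0Θ, hΘsub, hΘeq, hΘs, hΘs'⟩ :=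
    hΘ.exists_openPartialHomeomorph Metric.isOpen_ball hball0 eR hΘ'
  let ρ₀ : CSpace (r + 1) → ℝ := fun y => ρ (p₀ + eR (0, y))
  have hρ₀U : ∀ y ∈ Metric.ball (0 : CSpace (r + 1)) δ, p₀ + eR (0, y) ∈ U := by
    intro y hy
    have h1 := (hlevel (0, y) (by simpa [Prod.norm_def] using hy)).1
    rw [hf0 y hy] at h1
    exact h1
  have hρ₀ : ContDiffOn ℝ ∞ ρ₀ (Metric.ball 0 δ) :=
    hdef.contDiffOn.comp (contDiff_const.add
      (eR.contDiff.comp (contDiff_const.prodMk contDiff_id))).contDiffOn hρ₀U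
  let l : CSpace (r + 1) →L[ℝ] ℝ := ((fderiv ℝ ρ p₀).comp (eR : _ →L[ℝ] CSpace (n + 1))).comp
    (ContinuousLinearMap.inr ℝ (CSpace (n - r)) (CSpace (r + 1)))
  have hρ₀' : HasFDerivAt ρ₀ l 0 := by
    have h1 : HasFDerivAt ρ (fderiv ℝ ρ p₀) (p₀ + eR (0, 0)) := by
      have : p₀ + eR (0, 0) = p₀ := by
        rw [show ((0 : CSpace (n - r)), (0 : CSpace (r + 1))) = 0 from rfl, map_zero, add_zero]
      rw [this]
      exact ((hdef.contDiffOn.contDiffAt (hdef.isOpen.mem_nhds hpU)).differentiableAt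
        (by simp)).hasFDerivAt
    exact h1.comp (0 : CSpace (r + 1)) ((eR.hasFDerivAt.comp (0 : CSpace (r + 1))
      (hasFDerivAt_prodMk_right (0 : CSpace (n - r)) 0)).const_add p₀)
  -- Since `dρ` kills the horizontal directions `e (u, 0)`, it cannot also vanish on the vertical
  -- ones.
  have hl : l ≠ 0 := by
    intro hl0
    refine hdef.fderiv_ne_zero p₀ hpU (ContinuousLinearMap.ext fun v => ?_)
    obtain ⟨⟨u, y⟩, rfl⟩ := eR.surjective v
    have h1 : ((u, y) : CSpace (n - r) × CSpace (r + 1)) = (u, 0) + (0, y) := by simp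
    have h2 : fderiv ℝ ρ p₀ (eR (u, 0)) = 0 := heρ u
    have h3 : fderiv ℝ ρ p₀ (eR (0, y)) = 0 :=
      congrArg (fun L : CSpace (r + 1) →L[ℝ] ℝ => L y) hl0
    rw [h1, map_add, map_add, h2, h3, add_zero]
    rfl
  have hfinY : Module.finrank ℝ (CSpace (r + 1)) = (2 * r + 1) + 1 := by
    rw [← Module.finrank_mul_finrank ℝ ℂ (CSpace (r + 1)), Complex.finrank_real_complex,
      finrank_euclideanSpace_fin]
    ring
  obtain ⟨g, hg⟩ := exists_equiv_prod_of_functional hfinY l hl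
  -- Transverse coordinates with `ρ₀` itself as the last one. By `hlevel`, `ρ₀ y` is the value of
  -- `ρ` on the entire slice, so `M` becomes `{s = 0}`.
  let H : CSpace (r + 1) → EuclideanSpace ℝ (Fin (2 * r + 1)) × ℝ := fun y => ((g y).1, ρ₀ y)
  have hH : ContDiffOn ℝ ∞ H (Metric.ball 0 δ) :=
    (contDiff_fst.comp g.contDiff).contDiffOn.prodMk hρ₀
  have hH' : HasFDerivAt H (g : CSpace (r + 1) →L[ℝ] _) 0 := by
    refine (g.hasFDerivAt.fst.prodMk hρ₀').congr_fderiv (ContinuousLinearMap.ext fun y => ?_)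
    exact Prod.ext rfl (hg y).symm
  obtain ⟨eH, h0H, hHsub, hHeq, hHs, hHs'⟩ :=
    hH.exists_openPartialHomeomorph Metric.isOpen_ball (Metric.mem_ball_self hδ) g hH'
  have hH0 : H 0 = 0 := by
    refine Prod.ext ?_ ?_
    · change (g 0).1 = 0
      rw [map_zero]; rfl
    · change ρ (p₀ + eR 0) = 0
      rw [map_zero, add_zero, hp0]
  have hΘ0 : Θ 0 = p₀ := by
    change p₀ + eR (0, f 0) = p₀
    rw [hf00, show ((0 : CSpace (n - r)), (0 : CSpace (r + 1))) = 0 from rfl, map_zero, add_zero]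
  let G := (OpenPartialHomeomorph.refl (CSpace (n - r))).prod eH
  let Φ₀ := eΘ.symm.trans G
  have hp0s : p₀ ∈ Φ₀.source := by
    refine ⟨?_, ?_⟩
    · change p₀ ∈ eΘ.target
      rw [← hΘ0, ← hΘeq]
      exact eΘ.map_source h0Θ
    · change eΘ.symm p₀ ∈ G.source
      rw [← hΘ0, ← hΘeq, eΘ.left_inv h0Θ]
      exact ⟨Set.mem_univ _, h0H⟩
  have hΦp : Φ₀ p₀ = 0 := by
    change G (eΘ.symm p₀) = 0
    rw [← hΘ0, ← hΘeq, eΘ.left_inv h0Θ]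
    change ((0 : CSpace (n - r)), eH 0) = 0
    rw [hHeq, hH0]; rfl
  have h0t : (0 : CSpace (n - r) × EuclideanSpace ℝ (Fin (2 * r + 1)) × ℝ) ∈ Φ₀.target := by
    rw [← hΦp]; exact Φ₀.map_source hp0s
  obtain ⟨ε, hε, hεsub⟩ := Metric.isOpen_iff.1 Φ₀.open_target 0 h0t
  let B : Set (CSpace (n - r) × EuclideanSpace ℝ (Fin (2 * r + 1)) × ℝ) :=
    Metric.ball 0 ε ×ˢ Metric.ball 0 ε ×ˢ Metric.ball 0 ε
  have hBsub : B ⊆ Φ₀.target := by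
    rintro ⟨x, t, s⟩ ⟨hx, ht, hs⟩
    refine hεsub ?_
    rw [mem_ball_zero_iff] at hx ht hs ⊢
    simp only [Prod.norm_def, max_lt_iff]
    exact ⟨hx, ht, hs⟩
  have hB : IsOpen B := Metric.isOpen_ball.prod (Metric.isOpen_ball.prod Metric.isOpen_ball)
  -- `restrOpen` cuts down the source, so inverting twice cuts the target down to the product of
  -- balls.
  let Φ := (Φ₀.symm.restrOpen B hB).symm
  have hΦt : Φ.target = B := Set.inter_eq_right.2 hBsub
  have hΦs : ∀ z ∈ Φ.source, ∃ q ∈ eΘ.source, q.2 ∈ eH.source ∧ Θ q = z ∧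
      Φ z = (q.1, H q.2) := by
    intro z hz
    have hz0 : z ∈ Φ₀.source := hz.1
    refine ⟨eΘ.symm z, eΘ.map_target hz0.1, hz0.2.2, ?_, ?_⟩
    · rw [← hΘeq]; exact eΘ.right_inv hz0.1
    · rw [← hHeq]; rfl
  have hcoord : ∀ q, e.symm (Θ q - p₀) = (q.1, f q) := by
    intro q
    change e.symm (p₀ + e (q.1, f q) - p₀) = _
    rw [add_sub_cancel_left, e.symm_apply_apply]
  have hΦsymm : ∀ w ∈ B, (w.1, eH.symm w.2) ∈ eΘ.source ∧ w.2 ∈ eH.target ∧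
      Φ.symm w = Θ (w.1, eH.symm w.2) := by
    intro w hw
    have h1 := hBsub hw
    refine ⟨h1.2, h1.1.2, ?_⟩
    rw [← hΘeq]; rfl
  refine ⟨2 * r + 1, Φ, ε, by omega, hε, ⟨hp0s, ?_⟩, hΦt, ?_, ?_, ?_, fun t ht => ?_⟩
  · change Φ₀ p₀ ∈ B
    rw [hΦp]
    exact ⟨Metric.mem_ball_self hε, Metric.mem_ball_self hε, Metric.mem_ball_self hε⟩
  · have h1 : ContDiffOn ℝ ∞ G G.source :=
      (contDiffOn_fst).prodMk (hHs.comp contDiffOn_snd fun q hq => hq.2)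
    exact h1.comp (hΘs'.mono fun z hz => hz.1.1) fun z hz => hz.1.2
  · have h1 : ContDiffOn ℝ ∞ G.symm G.target :=
      (contDiffOn_fst).prodMk (hHs'.comp contDiffOn_snd fun q hq => hq.2)
    rw [hΦt]
    exact hΘs.comp (h1.mono fun w hw => (hBsub hw).1) fun w hw => (hBsub hw).2
  · ext z
    refine ⟨fun h => ⟨h.2, ?_⟩, fun h => ⟨?_, h.1⟩⟩
    all_goals
      obtain ⟨q, hq, -, rfl, hqΦ⟩ := hΦs z (by first | exact h.2 | exact h.1)
      have h1 := hlevel q (hΘsub hq)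
    · rw [hqΦ]
      exact h1.2.symm.trans ((hMU _ h1.1).1 h.1)
    · have h2 := h.2
      rw [hqΦ] at h2
      exact (hMU _ h1.1).2 (h1.2.trans h2)
  -- The initial value of the leaf: `H y = (t, 0)`, in particular `ρ₀ y = 0`, so `f (·, y)` has
  -- complex linear differential and the leaf is its graph.
  · let y := eH.symm (t, 0)
    have hxt : ∀ z ∈ Φ.source, ((Φ z).1, t, (0 : ℝ)) ∈ B := fun z hz =>
      ⟨(hΦt ▸ Φ.map_source hz).1, ht, Metric.mem_ball_self hε⟩
    have hfst : ∀ z ∈ Φ.source, (e.symm (z - p₀)).1 = (Φ z).1 := by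
      intro z hz
      obtain ⟨q, -, -, rfl, hqΦ⟩ := hΦs z hz
      rw [hqΦ, hcoord]
    have hmem : ∀ z ∈ Φ.source, ((e.symm (z - p₀)).1, y) ∈
        Metric.ball (0 : CSpace (n - r) × CSpace (r + 1)) δ := by
      intro z hz
      rw [hfst z hz]
      exact hΘsub (hΦsymm _ (hxt z hz)).1
    have hfd : ∀ z ∈ Φ.source, HasFDerivAt (fun x => f (x, y))
        ((fderiv ℝ f ((e.symm (z - p₀)).1, y)).comp
          (ContinuousLinearMap.inl ℝ (CSpace (n - r)) (CSpace (r + 1)))) (e.symm (z - p₀)).1 :=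
      fun z hz => ((hf.contDiffAt (Metric.isOpen_ball.mem_nhds (hmem z hz))).differentiableAt
        (by simp)).hasFDerivAt.comp (e.symm (z - p₀)).1 (hasFDerivAt_prodMk_left _ y)
    have hHy : ∀ z ∈ Φ.source, H y = (t, 0) := fun z hz => by
      rw [← hHeq]; exact eH.right_inv (hΦsymm _ (hxt z hz)).2.1
    refine isComplexSubmanifold_of_graph hdim e p₀ Φ.open_source (fun z hz => hz.1)
      (g := fun x => f (x, y)) (fun z hz => (hfd z hz).differentiableAt) (fun z hz u => ?_)
      fun z hz => ⟨fun h => ?_, fun h => ⟨hz, ?_⟩⟩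
    · rw [(hfd z hz).fderiv]
      exact hfI _ (hmem z hz) (congrArg Prod.snd (hHy z hz)) u
    · obtain ⟨q, -, hqH, rfl, hqΦ⟩ := hΦs z hz
      have h1 : H q.2 = (t, 0) := by
        have h2 := h.2
        rw [hqΦ] at h2
        exact Prod.ext h2.1 h2.2
      have h3 : q.2 = y := by
        rw [← eH.left_inv hqH, hHeq, h1]
      rw [hcoord]
      change f q = f (q.1, y)
      rw [← h3]
    -- A point of the graph is determined by its horizontal coordinate, so `z` is the point with
    -- chart coordinates `((Φ z).1, t, 0)`.
    · have h1 : Φ.symm ((Φ z).1, t, 0) = z := by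
        rw [(hΦsymm _ (hxt z hz)).2.2, ← hfst z hz]
        change p₀ + e ((e.symm (z - p₀)).1, f ((e.symm (z - p₀)).1, y)) = z
        rw [← h, Prod.mk.eta, e.apply_symm_apply, add_sub_cancel]
      have h2 : Φ z = ((Φ z).1, t, 0) := by
        conv_lhs => rw [← h1]
        exact Φ.right_inv (by rw [hΦt]; exact hxt z hz)
      rw [h2]
      exact ⟨rfl, rfl⟩
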